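/- **Setting.** Let $A\in\mathbb{R}^{n\times d}$, let $1\le k\le \operatorname{rank}(A)$, and let $\sigma_1\ge\sigma_2\ge\dots$ be the singular values of $A$ (with $\sigma_i=0$ for $i>\min(n,d)$); assume $\sigma_k>\sigma_{k+1}$. Write $X=U_X\Sigma_XV_X^T$ for a thin SVD of $X$ (statements hold for every choice of thin SVD), $V_{X,k}$ for the first $k$ columns of $V_X$, $U_{X,k+}$ for the columns of $U_X$ after the first $k$, $X^+$ for the Moore–Penrose pseudo-inverse, $\|\cdot\|_2$ for the Euclidean/spectral norm, $\mathrm{sr}(A)=\|A\|_F^2/\|A\|_2^2$ and $\mathrm{gap}_k(A)=(\sigma_k^2-\sigma_{k+1}^2)/\sigma_1^2$. A distribution on matrices $S$ with $m$ columns has the $(\varepsilon,\delta)$-approximate Gram matrix property for $X\in\mathbb{R}^{m\times p}$ if $\Pr\big(\|X^TS^TSX-X^TX\|_2\ge\varepsilon\|X\|_2^2\big)\le\delta$. For $b\in\mathbb{R}^n$ let $x_k=\arg\min_{x\in\operatorname{range}(V_{A,k})}\|Ax-b\|_2$ and, for $R\in\mathbb{R}^{d\times t}$, $x_{R,k}=RV_{AR,k}(ARV_{AR,k})^+b$.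 A vector $\tilde b$ is an $(\varepsilon,\upsilon)$-approximate PCP (of rank $k$) of $b$ if $\big|\|\tilde b-b\|_2-\|Ax_k-b\|_2\big|\le\varepsilon\|b\|_2$ and $\|U_{A,k+}^T\tilde b\|_2\le\upsilon\|b\|_2$. In the fixed design model $b=f+\xi$, where $f\in\mathbb{R}^n$ is fixed and the entries of $\xi$ are independent with mean $0$ and variance $\sigma^2$; $x^\star$ is the minimum norm minimizer of $\mathbb{E}\|Ax-b\|_2^2/n$, and the excess risk of an estimator $\theta=\theta(b)$ is $\mathcal{E}(\theta)=\mathbb{E}\|A\theta-Ax^\star\|_2^2/n$, the expectations being over $\xi$ only. **Theorem.** Let $\nu,\delta\in(0,1/2)$ and $\varepsilon=\frac{\nu}{1+\nu}\,\mathrm{gap}_k(A)$. 1. Suppose that $G\in\mathbb{R}^{t\times d}$ is sampled from a distribution that has the $(\varepsilon,\delta)$-approximate Gram matrix property for $A^T$. Then, with probability at least $1-\delta$ over $G$, for $R=G^T$: for every $b\in\mathbb{R}^n$ the vector $Ax_{R,k}$ is a $(\nu,\nu)$-approximate PCP of $b$, and $$\mathcal{E}(x_{R,k})\le\mathcal{E}(x_k)+\frac{(2\nu+\nu^2)\|f\|_2^2}{n}.$$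 2. There is an absolute constant $C>0$ such that if $G\in\mathbb{R}^{t\times d}$ is a CountSketch matrix (each column is, independently, a uniformly chosen identity vector multiplied by an independent uniform random sign) with $$t\ge C\,\frac{\mathrm{sr}(A)^2}{\mathrm{gap}_k(A)^2\,\nu^2\,\delta}$$ rows, then its distribution has the $(\varepsilon,\delta)$-approximate Gram matrix property for $A^T$. 3. For every $K>0$ there is a constant $C>0$ depending only on $K$ such that the following holds. Let $\rho$ be a probability distribution on $\mathbb{R}$ with variance $v>0$ such that, for some $c\le Kv$, $\int e^{sx}\,d\rho(x)\le e^{cs^2/2}$ for all $s\in\mathbb{R}$ (so $\rho$ is centered and subgaussian). If $G\in\mathbb{R}^{t\times d}$ is $1/\sqrt{tv}$ times a matrix with i.i.d. entries of law $\rho$, and $$t\ge C\,\frac{\mathrm{sr}(A)+\log(1/\delta)}{\mathrm{gap}_k(A)^2\,\nu^2},$$ then its distribution has the $(\varepsilon,\delta)$-approximate Gram matrix property for $A^T$. -/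

import Mathlib

open MeasureTheory ProbabilityTheory
open scoped NNReal ENNReal Matrix

noncomputable section

namespace SketchedPCR

/-- Real matrices carry the product (Borel) sigma-algebra of their entries. -/
instance matrixMeasurableSpace {m n : Type*} : MeasurableSpace (Matrix m n ℝ) :=
  inferInstanceAs (MeasurableSpace (m → n → ℝ))

section Matrices

variable {m n : Type*} [Fintype m] [DecidableEq m] [Fintype n] [DecidableEq n]

/-- The `i`-th largest singular value of `X`, with `i = 1, 2, …`; it is `0` for `i` larger than
the number of rows or of columns. (Mathlib's sequence is indexed from `0`; the index `i = 0` is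
not used.) -/
def sigma (X : Matrix m n ℝ) (i : ℕ) : ℝ :=
  (Matrix.toEuclideanLin X).singularValues (i - 1)

/-- The spectral norm: the operator norm of `X` for the Euclidean norms. -/
def specNorm (X : Matrix m n ℝ) : ℝ :=
  ‖LinearMap.toContinuousLinearMap (Matrix.toEuclideanLin X)‖

/-- The stable rank `‖X‖_F² / ‖X‖₂²`. -/
def stableRank (X : Matrix m n ℝ) : ℝ :=
  (∑ i, ∑ j, X i j ^ 2) / specNorm X ^ 2

/-- The `k`-th relative gap `(σ_k² - σ_{k+1}²) / σ_1²`. -/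
def gap (X : Matrix m n ℝ) (k : ℕ) : ℝ :=
  (sigma X k ^ 2 - sigma X (k + 1) ^ 2) / sigma X 1 ^ 2

/-- The diagonal matrix `Σ = diag (σ_1, σ_2, …)` of size `min (#rows) (#columns)`. -/
def sigmaDiag (X : Matrix m n ℝ) :
    Matrix (Fin (min (Fintype.card m) (Fintype.card n)))
      (Fin (min (Fintype.card m) (Fintype.card n))) ℝ :=
  Matrix.diagonal (fun i => sigma X (i.val + 1))

/-- The diagonal matrix `Σ⁺ = diag (σ_1⁺, σ_2⁺, …)`, where `σ⁺` is `σ⁻¹` if `σ ≠ 0` and is `0` if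
`σ = 0`. -/
def sigmaDiagPinv (X : Matrix m n ℝ) :
    Matrix (Fin (min (Fintype.card m) (Fintype.card n)))
      (Fin (min (Fintype.card m) (Fintype.card n))) ℝ :=
  Matrix.diagonal (fun i => (sigma X (i.val + 1))⁻¹)

/-- A thin singular value decomposition `X = U Σ Vᵀ`: `U` and `V` have `min (#rows) (#columns)`
orthonormal columns. -/
structure ThinSVD (X : Matrix m n ℝ) where
  U : Matrix m (Fin (min (Fintype.card m) (Fintype.card n))) ℝ
  V : Matrix n (Fin (min (Fintype.card m) (Fintype.card n))) ℝ
  U_orthonormal : Uᵀ * U = 1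
  V_orthonormal : Vᵀ * V = 1
  eq_mul : X = U * sigmaDiag X * Vᵀ

namespace ThinSVD

variable {X : Matrix m n ℝ} (s : ThinSVD X) (k : ℕ)

/-- The first `k` columns of `V`. -/
def Vk : Matrix n {i : Fin (min (Fintype.card m) (Fintype.card n)) // i.val < k} ℝ :=
  s.V.submatrix id Subtype.val

/-- The columns of `U` after the first `k`. -/
def UkPlus : Matrix m {i : Fin (min (Fintype.card m) (Fintype.card n)) // k ≤ i.val} ℝ :=
  s.U.submatrix id Subtype.val

end ThinSVD

/-- Every real matrix has a thin singular value decomposition. -/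
theorem nonempty_thinSVD (X : Matrix m n ℝ) : Nonempty (ThinSVD X) := by
  classical
  set T := Matrix.toEuclideanLin X with hT
  have hn : Module.finrank ℝ (EuclideanSpace ℝ n) = Fintype.card n := finrank_euclideanSpace
  have hm : Module.finrank ℝ (EuclideanSpace ℝ m) = Fintype.card m := finrank_euclideanSpace
  set v := T.isSymmetric_adjoint_comp_self.eigenvectorBasis hn with hv
  -- images of the right singular vectors are orthogonal
  have hTT : ∀ i j, inner ℝ (T (v i)) (T (v j)) = if i = j then T.singularValues i ^ 2 else 0 := by
    intro i j
    rw [← LinearMap.adjoint_inner_right, ← LinearMap.comp_apply,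
      T.isSymmetric_adjoint_comp_self.apply_eigenvectorBasis hn j, inner_smul_right,
      orthonormal_iff_ite.mp v.orthonormal i j, T.sq_singularValues_fin hn i]
    split_ifs with h
    · subst h; simp
    · simp
  have hr1 : Module.finrank ℝ (LinearMap.range T) ≤ Fintype.card n :=
    hn ▸ LinearMap.finrank_range_le T
  have hr2 : Module.finrank ℝ (LinearMap.range T) ≤ Fintype.card m :=
    hm ▸ Submodule.finrank_le _
  set r := Module.finrank ℝ (LinearMap.range T) with hr
  have hpos : ∀ i, i < r → T.singularValues i ≠ 0 := fun i hi =>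
    (T.singularValues_pos_iff_lt_finrank_range.mpr hi).ne'
  have hzero : ∀ i, r ≤ i → T.singularValues i = 0 := fun i hi =>
    T.singularValues_eq_zero_iff_le_finrank_range.mpr hi
  let u0 : Fin (Fintype.card m) → EuclideanSpace ℝ m := fun i =>
    if h : i.val < Fintype.card n then (T.singularValues i)⁻¹ • T (v ⟨i, h⟩) else 0
  obtain ⟨u, hu⟩ : ∃ u : OrthonormalBasis (Fin (Fintype.card m)) ℝ (EuclideanSpace ℝ m),
      ∀ i ∈ {i : Fin (Fintype.card m) | i.val < r}, u i = u0 i := by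
    apply Orthonormal.exists_orthonormalBasis_extension_of_card_eq
    · simp
    · rw [orthonormal_iff_ite]
      rintro ⟨i, hi⟩ ⟨j, hj⟩
      simp only [Set.mem_ofPred_eq] at hi hj
      have hi' := hi.trans_le hr1
      have hj' := hj.trans_le hr1
      simp only [Set.domRestrict_apply, u0, hi', hj', dif_pos, inner_smul_left, inner_smul_right, hTT]
      have := hpos i hi
      by_cases hij : i = j
      · subst hij
        simp
        field_simp
      · have : ¬ (i : ℕ) = j := fun h => hij (Fin.ext h)
        simp [hij, this]
  have hmm := Nat.min_le_left (Fintype.card m) (Fintype.card n)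
  have hmn := Nat.min_le_right (Fintype.card m) (Fintype.card n)
  let U : Matrix m (Fin (min (Fintype.card m) (Fintype.card n))) ℝ :=
    Matrix.of fun a i => u (Fin.castLE hmm i) a
  let V : Matrix n (Fin (min (Fintype.card m) (Fintype.card n))) ℝ :=
    Matrix.of fun a i => v (Fin.castLE hmn i) a
  have hV : Vᵀ * V = 1 := by
    ext i j
    have := orthonormal_iff_ite.mp v.orthonormal (Fin.castLE hmn j) (Fin.castLE hmn i)
    simp only [PiLp.inner_apply, Fin.castLE_inj] at this
    simp only [Matrix.mul_apply, Matrix.transpose_apply, Matrix.one_apply, V, Matrix.of_apply]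
    refine Eq.trans rfl (this.trans ?_)
    simp only [eq_comm]
  have hU : Uᵀ * U = 1 := by
    ext i j
    have := orthonormal_iff_ite.mp u.orthonormal (Fin.castLE hmm j) (Fin.castLE hmm i)
    simp only [PiLp.inner_apply, Fin.castLE_inj] at this
    simp only [Matrix.mul_apply, Matrix.transpose_apply, Matrix.one_apply, U, Matrix.of_apply]
    refine Eq.trans rfl (this.trans ?_)
    simp only [eq_comm]
  refine ⟨⟨U, V, hU, hV, ?_⟩⟩
  apply (Matrix.toEuclideanLin (𝕜 := ℝ)).injective
  refine v.toBasis.ext fun j => ?_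
  rw [OrthonormalBasis.coe_toBasis, ← hT]
  have hVv : ∀ i, (Vᵀ *ᵥ (v j).ofLp) i = if (Fin.castLE hmn i) = j then 1 else 0 := by
    intro i
    have := orthonormal_iff_ite.mp v.orthonormal j (Fin.castLE hmn i)
    simp only [PiLp.inner_apply] at this
    refine Eq.trans rfl (this.trans ?_)
    simp only [eq_comm]
  apply (WithLp.ofLp_injective 2)
  change _ = (U * sigmaDiag X * Vᵀ) *ᵥ (v j).ofLp
  have hmid : sigmaDiag X *ᵥ (Vᵀ *ᵥ (v j).ofLp) =
      fun i => T.singularValues i.val * if Fin.castLE hmn i = j then 1 else 0 := by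
    ext i
    rw [sigmaDiag, Matrix.mulVec_diagonal, hVv]
    rfl
  rw [← Matrix.mulVec_mulVec, ← Matrix.mulVec_mulVec, hmid]
  ext a
  simp only [Matrix.mulVec, dotProduct, U, Matrix.of_apply]
  by_cases hj : j.val < r
  · have hjm := hj.trans_le hr2
    rw [Finset.sum_eq_single (⟨j, lt_min hjm j.2⟩ : Fin _)]
    · have h1 := hu ⟨j, hjm⟩ hj
      simp only [u0, j.2, dif_pos, Fin.eta] at h1
      have h2 : u (Fin.castLE hmm ⟨j, lt_min hjm j.2⟩) =
        (T.singularValues j)⁻¹ • T (v j) := h1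
      rw [h2]
      have := hpos j hj
      simp
      field_simp
    · intro b _ hb
      have : ∀ x : Fin (min (Fintype.card m) (Fintype.card n)),
        (Fin.castLE hmn x = j) ↔ x.val = j.val := by intro x; simp [Fin.ext_iff]
      have hb' : ¬ b.val = j.val := fun h => hb (Fin.ext h)
      simp [this, hb']
    · simp
  · have h0 : T (v j) = 0 := by
      have := hTT j j
      rw [if_pos rfl, hzero _ (not_lt.mp hj)] at this
      simpa using this
    rw [h0]
    symm
    rw [PiLp.zero_apply]
    apply Finset.sum_eq_zero
    intro b _
    split_ifs with h
    · have : (b : ℕ) = j := congrArg Fin.val h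
      rw [this, hzero _ (not_lt.mp hj)]; simp
    · simp

/-- The Moore-Penrose pseudo-inverse `X⁺ = V Σ⁺ Uᵀ`, from a thin singular value decomposition
(the result does not depend on which one is taken). -/
def pinv (X : Matrix m n ℝ) : Matrix n m ℝ :=
  let s : ThinSVD X := Classical.choice (nonempty_thinSVD X)
  s.V * sigmaDiagPinv X * s.Uᵀ

end Matrices

section Regression

variable {n d t : ℕ}

/-- `x` is the PCR solution of rank `k` for the right hand side `b`: a minimizer of `‖A y - b‖`
over the column space of `V_{A,k}`. -/
def IsPCRSolution {A : Matrix (Fin n) (Fin d) ℝ} (s : ThinSVD A) (k : ℕ)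
    (b : EuclideanSpace ℝ (Fin n)) (x : EuclideanSpace ℝ (Fin d)) : Prop :=
  x ∈ LinearMap.range (Matrix.toEuclideanLin (s.Vk k)) ∧
    ∀ y ∈ LinearMap.range (Matrix.toEuclideanLin (s.Vk k)),
      ‖Matrix.toEuclideanLin A x - b‖ ≤ ‖Matrix.toEuclideanLin A y - b‖

/-- `b'` is an `(ε, υ)`-approximate PCP of rank `k` of `b`; here `A x_k` is the PCP of `b`. -/
def IsApproxPCP {A : Matrix (Fin n) (Fin d) ℝ} (s : ThinSVD A) (k : ℕ) (ε υ : ℝ)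
    (b b' : EuclideanSpace ℝ (Fin n)) : Prop :=
  (∃ x, IsPCRSolution s k b x ∧
    |‖b' - b‖ - ‖Matrix.toEuclideanLin A x - b‖| ≤ ε * ‖b‖) ∧
  ‖Matrix.toEuclideanLin (s.UkPlus k)ᵀ b'‖ ≤ υ * ‖b‖

/-- `x_{R,k} = R V_{AR,k} (A R V_{AR,k})⁺ b`. -/
def compressedPCR (A : Matrix (Fin n) (Fin d) ℝ) (R : Matrix (Fin d) (Fin t) ℝ)
    (s : ThinSVD (A * R)) (k : ℕ) (b : EuclideanSpace ℝ (Fin n)) : EuclideanSpace ℝ (Fin d) :=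
  Matrix.toEuclideanLin (R * s.Vk k * pinv (A * R * s.Vk k)) b

end Regression

section Risk

variable {n d : ℕ} {Ω : Type*} [MeasurableSpace Ω]

/-- The noisy response `b = f + ξ`. -/
def response (f : EuclideanSpace ℝ (Fin n)) (ξ : Fin n → Ω → ℝ) (ω : Ω) :
    EuclideanSpace ℝ (Fin n) :=
  f + WithLp.toLp 2 (fun i => ξ i ω)

/-- The entries of the noise are independent, square integrable, with mean `0` and variance
`σ²`. -/
structure IsNoise (μ : Measure Ω) (ξ : Fin n → Ω → ℝ) (σ : ℝ) : Prop where
  indep : iIndepFun ξ μ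
  memLp : ∀ i, MemLp (ξ i) 2 μ
  mean : ∀ i, ∫ ω, ξ i ω ∂μ = 0
  variance : ∀ i, Var[ξ i; μ] = σ ^ 2

/-- `𝔼 ‖A x - b‖² / n`, where `b = f + ξ`. -/
def predictionRisk (μ : Measure Ω) (ξ : Fin n → Ω → ℝ) (f : EuclideanSpace ℝ (Fin n))
    (A : Matrix (Fin n) (Fin d) ℝ) (x : EuclideanSpace ℝ (Fin d)) : ℝ :=
  ∫ ω, ‖Matrix.toEuclideanLin A x - response f ξ ω‖ ^ 2 / n ∂μ

/-- `x⋆` minimizes `𝔼 ‖A x - b‖² / n` over all `x`, and has minimum norm among the minimizers. -/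
def IsOptimalPredictor (μ : Measure Ω) (ξ : Fin n → Ω → ℝ) (f : EuclideanSpace ℝ (Fin n))
    (A : Matrix (Fin n) (Fin d) ℝ) (xstar : EuclideanSpace ℝ (Fin d)) : Prop :=
  (∀ y, predictionRisk μ ξ f A xstar ≤ predictionRisk μ ξ f A y) ∧
    ∀ x, (∀ y, predictionRisk μ ξ f A x ≤ predictionRisk μ ξ f A y) → ‖xstar‖ ≤ ‖x‖

/-- The excess risk `𝔼 ‖A θ(b) - A x⋆‖² / n` of an estimator `θ`; the expectation is over the
noise only. -/
def excessRisk (μ : Measure Ω) (ξ : Fin n → Ω → ℝ) (f : EuclideanSpace ℝ (Fin n))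
    (A : Matrix (Fin n) (Fin d) ℝ) (xstar : EuclideanSpace ℝ (Fin d))
    (θ : EuclideanSpace ℝ (Fin n) → EuclideanSpace ℝ (Fin d)) : ℝ :=
  ∫ ω, ‖Matrix.toEuclideanLin A (θ (response f ξ ω)) - Matrix.toEuclideanLin A xstar‖ ^ 2 / n ∂μ

end Risk

section Sketching

/-- The distribution `D` has the `(ε, δ)`-approximate Gram matrix property for `X`. -/
def ApproxGram {t m n : ℕ} (D : Measure (Matrix (Fin t) (Fin m) ℝ))
    (X : Matrix (Fin m) (Fin n) ℝ) (ε δ : ℝ) : Prop :=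
  IsProbabilityMeasure D ∧
    D {S | ε * specNorm X ^ 2 ≤ specNorm (Xᵀ * Sᵀ * S * X - Xᵀ * X)} ≤ ENNReal.ofReal δ

/-- The CountSketch distribution on `t × m` matrices: each column is, independently of the others,
a uniformly chosen identity vector times an independent uniform random sign. -/
def countSketch (t m : ℕ) : Measure (Matrix (Fin t) (Fin m) ℝ) :=
  (Measure.pi (fun _ : Fin m => uniformOn (Set.univ : Set (Fin t × Bool)))).map
    (fun ω => Matrix.of fun i j =>
      if (ω j).1 = i then (if (ω j).2 then (1 : ℝ) else -1) else 0)

/-- The distribution of the `t × m` matrix with i.i.d. entries of law `ρ`, multiplied by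
`1 / √(t v)`, where `v` is the variance of `ρ`. -/
def iidMap (t m : ℕ) (ρ : Measure ℝ) : Measure (Matrix (Fin t) (Fin m) ℝ) :=
  (Measure.pi (fun _ : Fin t => Measure.pi (fun _ : Fin m => ρ))).map
    (fun ω => Matrix.of fun i j => ω i j / √(t * Var[id; ρ]))

end Sketching

end SketchedPCR

end

open SketchedPCR

set_option linter.unusedSectionVars false

/-! The deterministic core is a comparison of two orthogonal projections. Put `H = A Gᵀ`. If `k ≤
rank H`, then `A x_{R,k}` is the projection `Q b` of `b` onto the top `k` left singular vectors of
`H`, and likewise `A x_k = P b` for those of `A`. The Gram matrix property for `Aᵀ` says that `H Hᵀ`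
is within `e = ν/(1+ν) · D` of `A Aᵀ`, where `D = σ_k² - σ_{k+1}²`. Weyl's inequality
(`sigma_sq_le`) leaves a gap of at least `D - e` between the relevant eigenvalues of the two Gram
matrices, and the sin Θ bound (`norm_compl_spectral_le`) gives `‖(1-Q)P‖, ‖(1-P)Q‖ ≤ e/(D-e) = ν`,
hence `‖P - Q‖ ≤ ν`. The PCP bounds are read off from these. In the excess risk the variance terms
are both `σ² k / n`, because the projections have equal rank, and the bias changes by at most `ν‖f‖`
in norm.

For CountSketch, `GᵀG - 1` consists of signed collisions. Sign symmetry makes them uncorrelated up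
to transposition, and each has second moment `1/t`. So the expected squared Frobenius error is at
most `2‖A‖_F⁴/t`, and Markov's inequality finishes.

For subgaussian entries the bound must depend on the stable rank and not on the dimension. The
singular directions are cut into blocks of `q = ⌈sr(A)⌉` consecutive indices. The leading singular
values of the blocks have squares summing to `W ≤ 2‖A‖²`, so the error is controlled by a weighted
quadratic mean of the errors on pairs of blocks. Each such error is bounded on nets of at most `5^q`
points. A union bound would pay for the number of blocks; instead, Jensen's inequality for `x ↦ cosh
(l √x)` moves the weighted mean outside, and Markov's inequality is applied to the resulting convex
combination, so only `25^q` is paid (`cosh_le_of_le_specNorm_gram`, `measure_le_of_iid_sketch`). The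
exponential moments come from the moment generating function of the square of a subgaussian variable
(`mgf_sq_sub_le`). -/

namespace SketchedPCR

/-! ### Operators diagonal in an orthonormal family, and the sin Θ bound -/

section DiagOp

variable {V ι : Type*} [NormedAddCommGroup V] [InnerProductSpace ℝ V] [Fintype ι]

/-- The operator `∑ φ i ⟪u i, ·⟫ u i`. -/
noncomputable def diagOp (u : ι → V) (φ : ι → ℝ) : V →L[ℝ] V :=
  ∑ i, φ i • (innerSL ℝ (u i)).smulRight (u i)

theorem diagOp_apply (u : ι → V) (φ : ι → ℝ) (x : V) :
    diagOp u φ x = ∑ i, (φ i * inner ℝ (u i) x) • u i := by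
  simp [diagOp, smul_smul]

theorem inner_diagOp {u : ι → V} (hu : Orthonormal ℝ u) (φ : ι → ℝ) (x : V) (i : ι) :
    inner ℝ (u i) (diagOp u φ x) = φ i * inner ℝ (u i) x := by
  rw [diagOp_apply, hu.inner_right_fintype]

theorem diagOp_diagOp {u : ι → V} (hu : Orthonormal ℝ u) (φ ψ : ι → ℝ) (x : V) :
    diagOp u φ (diagOp u ψ x) = diagOp u (fun i => φ i * ψ i) x := by
  rw [diagOp_apply u φ, diagOp_apply u (fun i => φ i * ψ i)]
  simp only [inner_diagOp hu, mul_assoc]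

theorem inner_diagOp_right (u : ι → V) (φ : ι → ℝ) (x y : V) :
    inner ℝ y (diagOp u φ x) = ∑ i, φ i * (inner ℝ (u i) x * inner ℝ (u i) y) := by
  rw [diagOp_apply, inner_sum]
  refine Finset.sum_congr rfl fun i _ => ?_
  rw [inner_smul_right, real_inner_comm (u i) y]
  ring

theorem inner_diagOp_comm (u : ι → V) (φ : ι → ℝ) (x y : V) :
    inner ℝ y (diagOp u φ x) = inner ℝ (diagOp u φ y) x := by
  rw [real_inner_comm x, inner_diagOp_right, inner_diagOp_right]
  simp only [mul_comm]

theorem norm_sq_sum_smul {u : ι → V} (hu : Orthonormal ℝ u) (c : ι → ℝ) :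
    ‖∑ i, c i • u i‖ ^ 2 = ∑ i, c i ^ 2 := by
  rw [← real_inner_self_eq_norm_sq, hu.inner_sum]
  simp [sq]

theorem norm_sq_diagOp {u : ι → V} (hu : Orthonormal ℝ u) (φ : ι → ℝ) (x : V) :
    ‖diagOp u φ x‖ ^ 2 = ∑ i, (φ i * inner ℝ (u i) x) ^ 2 := by
  rw [diagOp_apply, norm_sq_sum_smul hu]

theorem sum_inner_sq_le {u : ι → V} (hu : Orthonormal ℝ u) (x : V) :
    ∑ i, (inner ℝ (u i) x) ^ 2 ≤ ‖x‖ ^ 2 := by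
  simpa using hu.sum_inner_products_le x (s := Finset.univ)

theorem norm_diagOp_le {u : ι → V} (hu : Orthonormal ℝ u) {φ : ι → ℝ} {C : ℝ} (hC : 0 ≤ C)
    (hφ : ∀ i, |φ i| ≤ C) (x : V) : ‖diagOp u φ x‖ ≤ C * ‖x‖ := by
  refine abs_le_of_sq_le_sq' ?_ (by positivity) |>.2
  rw [norm_sq_diagOp hu, mul_pow]
  refine le_trans ?_ (mul_le_mul_of_nonneg_left (sum_inner_sq_le hu x) (sq_nonneg C))
  rw [Finset.mul_sum]
  refine Finset.sum_le_sum fun i _ => ?_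
  rw [mul_pow]
  exact mul_le_mul_of_nonneg_right (sq_le_sq' (abs_le.mp (hφ i)).1 (abs_le.mp (hφ i)).2)
    (sq_nonneg _)

/-- An indicator symbol makes the operator an orthogonal projection `Q`, so `‖y - Q y‖² = ‖y‖² - ‖Q
y‖²`. -/
theorem norm_sub_diagOp_indicator_le {u : ι → V} (hu : Orthonormal ℝ u) (I : Set ι)
    [DecidablePred (· ∈ I)] (y : V) :
    ‖y - diagOp u (fun i => if i ∈ I then 1 else 0) y‖ ≤ ‖y‖ := by
  set Q := diagOp u (fun i => if i ∈ I then 1 else 0) with hQ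
  have h1 : inner ℝ y (Q y) = ‖Q y‖ ^ 2 := by
    rw [hQ, norm_sq_diagOp hu, inner_diagOp_right]
    refine Finset.sum_congr rfl fun i _ => ?_
    split_ifs <;> ring
  refine abs_le_of_sq_le_sq' ?_ (norm_nonneg _) |>.2
  rw [norm_sub_sq_real, h1]
  nlinarith [sq_nonneg ‖Q y‖]

/-- The `sin Θ` bound for spectral subspaces of two operators that are diagonal in orthonormal
families. -/
theorem norm_compl_spectral_le {κ : Type*} [Fintype κ] [FiniteDimensional ℝ V]
    {u : ι → V} {w : κ → V} (hu : Orthonormal ℝ u)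
    (hw : Orthonormal ℝ w) {φ : ι → ℝ} {ψ : κ → ℝ} {I : Set ι} {J : Set κ}
    [DecidablePred (· ∈ I)] [DecidablePred (· ∈ J)] {α β e : ℝ} (hα : 0 < α)
    (hβ : 0 ≤ β) (hφ : ∀ i ∈ I, α ≤ φ i) (hψ : ∀ j ∉ J, |ψ j| ≤ β)
    (hd : ∀ x, ‖diagOp u φ x - diagOp w ψ x‖ ≤ e * ‖x‖) (x : V) :
    let P := diagOp u (fun i => if i ∈ I then 1 else 0)
    let Q := diagOp w (fun j => if j ∈ J then 1 else 0)
    (α - β) * ‖P x - Q (P x)‖ ≤ e * ‖x‖ := by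
  intro P Q
  have hQn : ∀ y, ‖y - Q y‖ ≤ ‖y‖ := norm_sub_diagOp_indicator_le hw J
  have hMQ : ∀ y, diagOp w ψ y - Q (diagOp w ψ y) = diagOp w ψ (y - Q y) := by
    intro y
    rw [map_sub, diagOp_diagOp hw, diagOp_diagOp hw]
    simp only [mul_comm]
  have hMQ' : ∀ y, ‖diagOp w ψ (y - Q y)‖ ≤ β * ‖y - Q y‖ := by
    intro y
    have : diagOp w ψ (y - Q y) = diagOp w (fun j => if j ∈ J then 0 else ψ j) (y - Q y) := by
      rw [diagOp_apply w ψ, diagOp_apply w (fun j => if j ∈ J then 0 else ψ j)]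
      refine Finset.sum_congr rfl fun j _ => ?_
      rw [inner_sub_right, inner_diagOp hw]
      split_ifs <;> simp
    rw [this]
    refine norm_diagOp_le hw hβ (fun j => ?_) _
    split_ifs with h
    · simpa using hβ
    · exact hψ j h
  let W : V →L[ℝ] V := (1 - Q) ∘L P
  have hW : ∀ y, W y = P y - Q (P y) := fun y => by simp [W]
  -- `R` inverts `diagOp u φ` on the range of `P`. Writing `N`, `M` for the two operators, `W =
  -- (1-Q)NR = (1-Q)(N-M)R + M W R`, because `Q` commutes with `M` and `PR = R`. This bounds `‖W‖`
  -- in terms of itself, with factor `β/α`.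
  let R := diagOp u (fun i => if i ∈ I then (φ i)⁻¹ else 0)
  have hR : ∀ y, ‖R y‖ ≤ α⁻¹ * ‖y‖ := fun y => by
    refine norm_diagOp_le hu (inv_nonneg.mpr hα.le) (fun i => ?_) y
    split_ifs with h
    · rw [abs_inv, abs_of_pos (hα.trans_le (hφ i h))]
      exact inv_anti₀ hα (hφ i h)
    · simpa using hα.le
  have hPR : ∀ y, P (R y) = R y := fun y => by
    rw [diagOp_diagOp hu]; congr 2; ext i; split_ifs <;> simp
  have hNR : ∀ y, diagOp u φ (R y) = P y := fun y => by
    rw [diagOp_diagOp hu]; congr 2; ext i; split_ifs with h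
    · exact mul_inv_cancel₀ (hα.trans_le (hφ i h)).ne'
    · simp
  have key : ∀ y, ‖W y‖ ≤ ((e + β * ‖W‖) * α⁻¹) * ‖y‖ := by
    intro y
    have h1 : W y = ((diagOp u φ (R y) - diagOp w ψ (R y))
        - Q (diagOp u φ (R y) - diagOp w ψ (R y))) + diagOp w ψ (W (R y)) := by
      rw [hW, hW, hPR, ← hMQ, hNR, map_sub]; abel
    have h2 : ‖diagOp w ψ (W (R y))‖ ≤ β * (‖W‖ * ‖R y‖) := by
      rw [hW (R y)]
      refine (hMQ' _).trans (mul_le_mul_of_nonneg_left ?_ hβ)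
      rw [← hW]; exact W.le_opNorm _
    have h3 := (hQn (diagOp u φ (R y) - diagOp w ψ (R y))).trans (hd (R y))
    calc ‖W y‖ ≤ e * ‖R y‖ + β * (‖W‖ * ‖R y‖) := by
          rw [h1]; exact (norm_add_le _ _).trans (add_le_add h3 h2)
      _ = (e + β * ‖W‖) * ‖R y‖ := by ring
      _ ≤ (e + β * ‖W‖) * (α⁻¹ * ‖y‖) := by
          -- The sign of `e` is not assumed; `hd` at a nonzero vector forces `0 ≤ e`.
          by_cases hy : R y = 0
          · have : 0 ≤ (e + β * ‖W‖) ∨ y = 0 := by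
              by_cases hy0 : y = 0
              · exact Or.inr hy0
              · left
                have := (norm_nonneg _).trans (hd y)
                have : 0 ≤ e := nonneg_of_mul_nonneg_left this (norm_pos_iff.mpr hy0)
                positivity
            rcases this with h | h
            · exact mul_le_mul_of_nonneg_left (hR y) h
            · simp [h]
          · have := (norm_nonneg _).trans (hd (R y))
            have : 0 ≤ e := nonneg_of_mul_nonneg_left this (norm_pos_iff.mpr hy)
            exact mul_le_mul_of_nonneg_left (hR y) (by positivity)
      _ = _ := by ring
  rw [← hW]
  by_cases hx : x = 0
  · simp [hx]
  have he : 0 ≤ e := nonneg_of_mul_nonneg_left ((norm_nonneg _).trans (hd x)) (norm_pos_iff.mpr hx)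
  have hWn : ‖W‖ ≤ (e + β * ‖W‖) * α⁻¹ :=
    ContinuousLinearMap.opNorm_le_bound _ (by positivity) key
  have h5 : (α - β) * ‖W‖ ≤ e := by
    rw [← div_eq_mul_inv, le_div_iff₀ hα] at hWn
    linarith
  rcases le_total (α - β) 0 with h | h
  · exact (mul_nonpos_of_nonpos_of_nonneg h (norm_nonneg _)).trans (by positivity)
  · calc (α - β) * ‖W x‖ ≤ (α - β) * (‖W‖ * ‖x‖) := by gcongr; exact W.le_opNorm x
      _ = ((α - β) * ‖W‖) * ‖x‖ := by ring
      _ ≤ e * ‖x‖ := by gcongr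

end DiagOp

/-! ### Singular vectors and Weyl's inequality -/

section SVD

variable {m n : Type*} [Fintype m] [DecidableEq m] [Fintype n] [DecidableEq n]

theorem sigma_nonneg (X : Matrix m n ℝ) (i : ℕ) : 0 ≤ sigma X i :=
  LinearMap.singularValues_nonneg _ _

theorem sigma_anti (X : Matrix m n ℝ) {i j : ℕ} (h : i ≤ j) : sigma X j ≤ sigma X i :=
  LinearMap.singularValues_antitone _ (Nat.sub_le_sub_right h 1)

theorem finrank_range_toEuclideanLin (X : Matrix m n ℝ) :
    Module.finrank ℝ (LinearMap.range (Matrix.toEuclideanLin X)) = X.rank := by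
  rw [Matrix.rank_eq_finrank_range_toLin X (EuclideanSpace.basisFun m ℝ).toBasis
    (EuclideanSpace.basisFun n ℝ).toBasis, Matrix.toEuclideanLin_eq_toLin_orthonormal]

theorem sigma_pos_iff (X : Matrix m n ℝ) {i : ℕ} (hi : 1 ≤ i) : 0 < sigma X i ↔ i ≤ X.rank := by
  rw [sigma, LinearMap.singularValues_pos_iff_lt_finrank_range, finrank_range_toEuclideanLin]
  omega

theorem rank_le_min (X : Matrix m n ℝ) : X.rank ≤ min (Fintype.card m) (Fintype.card n) :=
  le_min (Matrix.rank_le_card_height X) (Matrix.rank_le_card_width X)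

namespace ThinSVD

variable {X : Matrix m n ℝ} (s : ThinSVD X)

/-- The left singular vectors. -/
noncomputable def u (i : Fin (min (Fintype.card m) (Fintype.card n))) : EuclideanSpace ℝ m :=
  WithLp.toLp 2 (s.Uᵀ i)

/-- The right singular vectors. -/
noncomputable def v (i : Fin (min (Fintype.card m) (Fintype.card n))) : EuclideanSpace ℝ n :=
  WithLp.toLp 2 (s.Vᵀ i)

theorem orthonormal_u : Orthonormal ℝ s.u := by
  rw [orthonormal_iff_ite]
  intro i j
  have := congrFun (congrFun s.U_orthonormal j) i
  rw [Matrix.one_apply] at this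
  simp only [eq_comm (a := i), ← this]
  simp [u, PiLp.inner_apply, Matrix.mul_apply]

theorem orthonormal_v : Orthonormal ℝ s.v := by
  rw [orthonormal_iff_ite]
  intro i j
  have := congrFun (congrFun s.V_orthonormal j) i
  rw [Matrix.one_apply] at this
  simp only [eq_comm (a := i), ← this]
  simp [v, PiLp.inner_apply, Matrix.mul_apply]

theorem apply_eq (x : EuclideanSpace ℝ n) :
    Matrix.toEuclideanLin X x = ∑ i, (sigma X (i.val + 1) * inner ℝ (s.v i) x) • s.u i := by
  ext a
  conv_lhs => rw [s.eq_mul]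
  simp [Matrix.toLpLin_apply, -Matrix.mulVec_mulVec, sigmaDiag,
    Matrix.mulVec, dotProduct, Matrix.diagonal_apply, u, v, PiLp.inner_apply, mul_comm]

theorem transpose_apply_eq (x : EuclideanSpace ℝ m) :
    Matrix.toEuclideanLin Xᵀ x = ∑ i, (sigma X (i.val + 1) * inner ℝ (s.u i) x) • s.v i := by
  ext a
  conv_lhs => rw [s.eq_mul]
  simp [Matrix.toLpLin_apply, -Matrix.mulVec_mulVec, sigmaDiag,
    Matrix.mulVec, dotProduct, Matrix.diagonal_apply, u, v, PiLp.inner_apply, mul_comm]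

theorem apply_v (i) : Matrix.toEuclideanLin X (s.v i) = sigma X (i + 1) • s.u i := by
  rw [s.apply_eq, Finset.sum_eq_single i]
  · simp [s.orthonormal_v.norm_eq_one]
  · intro j _ h
    simp [orthonormal_iff_ite.mp s.orthonormal_v, h]
  · simp

theorem norm_sq_transpose_apply (x : EuclideanSpace ℝ m) :
    ‖Matrix.toEuclideanLin Xᵀ x‖ ^ 2 = ∑ i, (sigma X (i.val + 1) * inner ℝ (s.u i) x) ^ 2 := by
  rw [s.transpose_apply_eq, norm_sq_sum_smul s.orthonormal_v]

theorem mul_transpose_apply (x : EuclideanSpace ℝ m) :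
    Matrix.toEuclideanLin (X * Xᵀ) x = diagOp s.u (fun i => sigma X (i + 1) ^ 2) x := by
  have : Matrix.toEuclideanLin (X * Xᵀ) x =
      Matrix.toEuclideanLin X (Matrix.toEuclideanLin Xᵀ x) := by
    simp [Matrix.toLpLin_apply]
  rw [this, s.transpose_apply_eq, map_sum, diagOp_apply]
  refine Finset.sum_congr rfl fun i _ => ?_
  rw [map_smul, s.apply_v, smul_smul]
  congr 1; ring

/-- The orthogonal projection onto the span of the first `k` left singular vectors. -/
noncomputable def proj (k : ℕ) : EuclideanSpace ℝ m →L[ℝ] EuclideanSpace ℝ m :=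
  diagOp s.u (fun i => if i ∈ {i : Fin (min (Fintype.card m) (Fintype.card n)) | i.val < k}
    then 1 else 0)

end ThinSVD

/-- Courant–Fischer by counting dimensions: the span of the first `k` left singular vectors of `X`
contains a nonzero `x` orthogonal to the first `k - 1` left singular vectors of `Y`. There `‖Xᵀx‖² ≥
σ_k(X)²‖x‖²` and `‖Yᵀx‖² ≤ σ_k(Y)²‖x‖²`. -/
theorem sigma_sq_le {n' : Type*} [Fintype n'] [DecidableEq n'] (X : Matrix m n ℝ)
    (Y : Matrix m n' ℝ) {e : ℝ} (he : 0 ≤ e)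
    (h : ∀ x, ‖Matrix.toEuclideanLin Xᵀ x‖ ^ 2 ≤ ‖Matrix.toEuclideanLin Yᵀ x‖ ^ 2 + e * ‖x‖ ^ 2)
    {k : ℕ} (hk : 1 ≤ k) : sigma X k ^ 2 ≤ sigma Y k ^ 2 + e := by
  rcases (sigma_nonneg X k).eq_or_lt with h0 | h0
  · rw [← h0]
    nlinarith [sq_nonneg (sigma Y k)]
  have hkr := ((sigma_pos_iff X hk).mp h0).trans (rank_le_min X)
  obtain ⟨s⟩ := nonempty_thinSVD X
  obtain ⟨r⟩ := nonempty_thinSVD Y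
  let F : (Fin k → ℝ) →ₗ[ℝ] (Fin (k - 1) → ℝ) :=
    -- The constraint is void (`0`) when `Y` has fewer than `k - 1` left singular vectors.
    LinearMap.pi fun j => if hj : j.val < min (Fintype.card m) (Fintype.card n') then
      (innerSL ℝ (r.u ⟨j, hj⟩)).toLinearMap ∘ₗ
        (Fintype.linearCombination ℝ (fun i : Fin k => s.u (Fin.castLE hkr i))) else 0
  have hF : F.ker ≠ ⊥ := by
    apply LinearMap.ker_ne_bot_of_finrank_lt
    simp; omega
  obtain ⟨c, hc, hc0⟩ := Submodule.exists_mem_ne_zero_of_ne_bot hF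
  have hinj : Function.Injective (fun i : Fin k => Fin.castLE hkr i) := Fin.castLE_injective hkr
  have hon := s.orthonormal_u.comp _ hinj
  set x := ∑ i, c i • s.u (Fin.castLE hkr i) with hx
  have hxn : ‖x‖ ^ 2 = ∑ i, c i ^ 2 := norm_sq_sum_smul hon c
  have hxpos : 0 < ‖x‖ ^ 2 := by
    rw [hxn]
    obtain ⟨i, hi⟩ : ∃ i, c i ≠ 0 := by
      by_contra! hh; exact hc0 (funext hh)
    exact Finset.sum_pos' (fun _ _ => sq_nonneg _) ⟨i, Finset.mem_univ _, sq_pos_of_ne_zero hi⟩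
  have hin : ∀ i, inner ℝ (s.u (Fin.castLE hkr i)) x = c i := fun i =>
    hon.inner_right_fintype c i
  have hlow : sigma X k ^ 2 * ‖x‖ ^ 2 ≤ ‖Matrix.toEuclideanLin Xᵀ x‖ ^ 2 := by
    rw [s.norm_sq_transpose_apply, hxn, Finset.mul_sum]
    calc ∑ i, sigma X k ^ 2 * c i ^ 2
        ≤ ∑ i : Fin k, (sigma X ((Fin.castLE hkr i).val + 1) *
            inner ℝ (s.u (Fin.castLE hkr i)) x) ^ 2 := by
          refine Finset.sum_le_sum fun i _ => ?_
          rw [hin, mul_pow]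
          have : sigma X k ≤ sigma X ((Fin.castLE hkr i).val + 1) :=
            sigma_anti X (by simp)
          have h3 := sigma_nonneg X k
          gcongr
      _ ≤ _ := by
          refine (Finset.sum_map Finset.univ ⟨_, hinj⟩
            (fun j => (sigma X (j.val + 1) * inner ℝ (s.u j) x) ^ 2)).symm.trans_le ?_
          exact Finset.sum_le_sum_of_subset_of_nonneg (Finset.subset_univ _)
            fun _ _ _ => sq_nonneg _
  have hup : ‖Matrix.toEuclideanLin Yᵀ x‖ ^ 2 ≤ sigma Y k ^ 2 * ‖x‖ ^ 2 := by
    rw [r.norm_sq_transpose_apply]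
    refine le_trans ?_ (mul_le_mul_of_nonneg_left (sum_inner_sq_le r.orthonormal_u x)
      (sq_nonneg _))
    rw [Finset.mul_sum]
    refine Finset.sum_le_sum fun j _ => ?_
    by_cases hj : j.val < k - 1
    · have : inner ℝ (r.u j) x = 0 := by
        have := congrFun (LinearMap.mem_ker.mp hc) ⟨j, hj⟩
        simp only [F, LinearMap.pi_apply, dif_pos j.2, LinearMap.comp_apply, Fin.eta,
          Fintype.linearCombination_apply, ← hx] at this
        exact this
      simp [this]
    · rw [mul_pow]
      have : sigma Y (j.val + 1) ≤ sigma Y k := sigma_anti Y (by omega)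
      have h3 := sigma_nonneg Y (j.val + 1)
      gcongr
  have := h x
  have : sigma X k ^ 2 * ‖x‖ ^ 2 ≤ (sigma Y k ^ 2 + e) * ‖x‖ ^ 2 := by linarith
  exact le_of_mul_le_mul_right this hxpos

end SVD

end SketchedPCR

namespace SketchedPCR

/-! ### Spectral norm -/

section SpecNorm

variable {m n : Type*} [Fintype m] [DecidableEq m] [Fintype n] [DecidableEq n]

theorem norm_apply_le_specNorm (X : Matrix m n ℝ) (x : EuclideanSpace ℝ n) :
    ‖Matrix.toEuclideanLin X x‖ ≤ specNorm X * ‖x‖ :=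
  (LinearMap.toContinuousLinearMap (Matrix.toEuclideanLin X)).le_opNorm x

theorem specNorm_le {X : Matrix m n ℝ} {C : ℝ} (hC : 0 ≤ C)
    (h : ∀ x, ‖Matrix.toEuclideanLin X x‖ ≤ C * ‖x‖) : specNorm X ≤ C :=
  ContinuousLinearMap.opNorm_le_bound _ hC h

theorem specNorm_nonneg (X : Matrix m n ℝ) : 0 ≤ specNorm X := norm_nonneg _

theorem inner_toEuclideanLin_transpose (X : Matrix m n ℝ) (x : EuclideanSpace ℝ n)
    (y : EuclideanSpace ℝ m) :
    inner ℝ (Matrix.toEuclideanLin Xᵀ y) x = inner ℝ y (Matrix.toEuclideanLin X x) := by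
  simp only [Matrix.toLpLin_apply, PiLp.inner_apply, Matrix.mulVec, dotProduct,
    Matrix.transpose_apply, RCLike.inner_apply, conj_trivial, Finset.mul_sum, Finset.sum_mul]
  rw [Finset.sum_comm]
  exact Finset.sum_congr rfl fun _ _ => Finset.sum_congr rfl fun _ _ => by ring

theorem toEuclideanLin_mul_apply {l : Type*} [Fintype l] [DecidableEq l] (X : Matrix m n ℝ)
    (Y : Matrix n l ℝ) (x : EuclideanSpace ℝ l) :
    Matrix.toEuclideanLin (X * Y) x = Matrix.toEuclideanLin X (Matrix.toEuclideanLin Y x) := by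
  simp [Matrix.toLpLin_apply]

theorem specNorm_transpose_le (X : Matrix m n ℝ) : specNorm Xᵀ ≤ specNorm X := by
  refine specNorm_le (specNorm_nonneg X) fun y => ?_
  rcases (norm_nonneg (Matrix.toEuclideanLin Xᵀ y)).eq_or_lt with h | h
  · rw [← h]
    exact mul_nonneg (specNorm_nonneg X) (norm_nonneg _)
  refine le_of_mul_le_mul_right ?_ h
  rw [← real_inner_self_eq_norm_mul_norm, inner_toEuclideanLin_transpose]
  calc _ ≤ ‖y‖ * (specNorm X * ‖Matrix.toEuclideanLin Xᵀ y‖) :=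
        (real_inner_le_norm _ _).trans
          (mul_le_mul_of_nonneg_left (norm_apply_le_specNorm _ _) (norm_nonneg _))
    _ = _ := by ring

theorem specNorm_transpose (X : Matrix m n ℝ) : specNorm Xᵀ = specNorm X :=
  (specNorm_transpose_le X).antisymm (by simpa using specNorm_transpose_le Xᵀ)

theorem specNorm_eq_sigma_one (X : Matrix m n ℝ) : specNorm X = sigma X 1 := by
  obtain ⟨s⟩ := nonempty_thinSVD X
  refine le_antisymm ?_ ?_
  · rw [← specNorm_transpose]
    refine specNorm_le (sigma_nonneg X 1) fun x => ?_
    refine abs_le_of_sq_le_sq' ?_ (mul_nonneg (sigma_nonneg X 1) (norm_nonneg _)) |>.2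
    rw [s.norm_sq_transpose_apply, mul_pow]
    refine le_trans ?_ (mul_le_mul_of_nonneg_left (sum_inner_sq_le s.orthonormal_u x)
      (sq_nonneg _))
    rw [Finset.mul_sum]
    refine Finset.sum_le_sum fun i _ => ?_
    rw [mul_pow]
    have h1 := sigma_nonneg X (i.val + 1)
    have h2 : sigma X (i.val + 1) ≤ sigma X 1 := sigma_anti X (by omega)
    gcongr
  · rcases (sigma_nonneg X 1).eq_or_lt with h | h
    · rw [← h]; exact specNorm_nonneg X
    have hr := ((sigma_pos_iff X le_rfl).mp h).trans (rank_le_min X)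
    have h1 := norm_apply_le_specNorm X (s.v ⟨0, hr⟩)
    rw [s.apply_v, norm_smul, s.orthonormal_u.norm_eq_one, s.orthonormal_v.norm_eq_one] at h1
    simpa [abs_of_pos h] using h1

end SpecNorm

/-! ### The projection `X X⁺` -/

section Pinv

variable {m n : Type*} [Fintype m] [DecidableEq m] [Fintype n] [DecidableEq n]

theorem exists_mul_pinv_eq (X : Matrix m n ℝ) : ∃ s : ThinSVD X,
    X * pinv X = s.U * (sigmaDiag X * sigmaDiagPinv X) * s.Uᵀ := by
  refine ⟨Classical.choice (nonempty_thinSVD X), ?_⟩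
  set s := Classical.choice (nonempty_thinSVD X) with hs
  change X * (s.V * sigmaDiagPinv X * s.Uᵀ) = _
  conv_lhs => lhs; rw [s.eq_mul]
  rw [show s.U * sigmaDiag X * s.Vᵀ * (s.V * sigmaDiagPinv X * s.Uᵀ) =
    s.U * sigmaDiag X * (s.Vᵀ * s.V) * sigmaDiagPinv X * s.Uᵀ by simp only [Matrix.mul_assoc],
    s.V_orthonormal, Matrix.mul_one]
  simp only [Matrix.mul_assoc]

theorem transpose_mul_pinv (X : Matrix m n ℝ) : (X * pinv X)ᵀ = X * pinv X := by
  obtain ⟨s, hs⟩ := exists_mul_pinv_eq X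
  rw [hs, Matrix.transpose_mul, Matrix.transpose_mul, Matrix.transpose_transpose, sigmaDiag,
    sigmaDiagPinv, Matrix.diagonal_mul_diagonal, Matrix.diagonal_transpose, Matrix.mul_assoc]

theorem mul_pinv_mul (X : Matrix m n ℝ) : X * pinv X * X = X := by
  obtain ⟨s, hs⟩ := exists_mul_pinv_eq X
  rw [hs]
  conv_lhs => rhs; rw [s.eq_mul]
  conv_rhs => rw [s.eq_mul]
  rw [show s.U * (sigmaDiag X * sigmaDiagPinv X) * s.Uᵀ * (s.U * sigmaDiag X * s.Vᵀ) =
    s.U * (sigmaDiag X * sigmaDiagPinv X) * (s.Uᵀ * s.U) * sigmaDiag X * s.Vᵀ by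
      simp only [Matrix.mul_assoc], s.U_orthonormal, Matrix.mul_one, Matrix.mul_assoc s.U]
  congr 2
  simp only [sigmaDiag, sigmaDiagPinv, Matrix.diagonal_mul_diagonal]
  congr 1
  ext i
  by_cases h : sigma X (i.val + 1) = 0
  · simp [h]
  · field_simp

/-- A symmetric matrix `P = X Y` with `P X = X` equals `X X⁺`. -/
theorem mul_pinv_eq_of_symm (X : Matrix m n ℝ) {P : Matrix m m ℝ} {Y : Matrix n m ℝ}
    (hP : Pᵀ = P) (hPX : P * X = X) (hY : P = X * Y) : X * pinv X = P := by
  have h1 : X * pinv X * P = P := by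
    conv_lhs => rw [hY, ← Matrix.mul_assoc, mul_pinv_mul]
    exact hY.symm
  have h2 : P * (X * pinv X) = X * pinv X := by rw [← Matrix.mul_assoc, hPX]
  -- Both factors are symmetric, so transposing `X X⁺ P = P` gives `P X X⁺ = P`, while `P X X⁺ = X
  -- X⁺` by `h2`.
  rw [← h1, ← transpose_mul_pinv, ← hP, ← Matrix.transpose_mul, h2]

end Pinv

/-! ### Fitted vectors as spectral projections -/

namespace ThinSVD

variable {m n : Type*} [Fintype m] [DecidableEq m] [Fintype n] [DecidableEq n]
  {X : Matrix m n ℝ} (s : ThinSVD X)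

theorem toEuclideanLin_mul_transpose_Uk (k : ℕ) (b : EuclideanSpace ℝ m) :
    Matrix.toEuclideanLin (s.U.submatrix id (Subtype.val : {i // i.val < k} → _) *
      (s.U.submatrix id (Subtype.val : {i // i.val < k} → _))ᵀ) b = s.proj k b := by
  rw [proj, diagOp_apply]
  ext a
  simp only [Matrix.toLpLin_apply, ← Matrix.mulVec_mulVec]
  simp only [Matrix.mulVec, dotProduct, Matrix.submatrix_apply, id, Matrix.transpose_apply,
    WithLp.ofLp_sum, Finset.sum_apply, u, PiLp.inner_apply, WithLp.ofLp_smul, Pi.smul_apply,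
    smul_eq_mul, RCLike.inner_apply, conj_trivial, Set.mem_ofPred_eq, ite_mul, one_mul, zero_mul]
  rw [← Finset.sum_filter, ← Finset.sum_subtype_eq_sum_filter]
  simp only [Finset.subtype_univ, mul_comm]

/-- The product of `X` with its first `k` right singular vectors and the pseudo-inverse is the
spectral projection. -/
theorem mul_Vk_mul_pinv {k : ℕ} (hk : k ≤ X.rank) (b : EuclideanSpace ℝ m) :
    Matrix.toEuclideanLin (X * s.Vk k * pinv (X * s.Vk k)) b = s.proj k b := by
  rw [← toEuclideanLin_mul_transpose_Uk]
  congr 2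
  set Uk : Matrix m {i : Fin (min (Fintype.card m) (Fintype.card n)) // i.val < k} ℝ :=
    s.U.submatrix id Subtype.val with hUk
  let D : {i : Fin (min (Fintype.card m) (Fintype.card n)) // i.val < k} → ℝ :=
    fun i => sigma X (i.val.val + 1)
  have hD : ∀ i, D i ≠ 0 := fun i =>
    ((sigma_pos_iff X (by omega)).mpr (by have := i.2; omega)).ne'
  have hUU : Ukᵀ * Uk = 1 := by
    ext i j
    have := congrFun (congrFun s.U_orthonormal i.val) j.val
    rw [Matrix.one_apply] at this ⊢
    simp only [Subtype.ext_iff]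
    rw [← this]; rfl
  have hX : X * s.Vk k = Uk * Matrix.diagonal D := by
    conv_lhs => lhs; rw [s.eq_mul]
    have h1 : s.Vᵀ * s.Vk k = (1 : Matrix _ _ ℝ).submatrix id Subtype.val := by
      rw [← s.V_orthonormal]; rfl
    rw [Matrix.mul_assoc, h1]
    ext a i
    simp [sigmaDiag, Matrix.mul_apply, Matrix.diagonal_apply, Matrix.one_apply, Uk, D]
  -- The pseudo-inverse of `X V_k` comes from an unrelated SVD, so `U_k U_kᵀ` is identified by
  -- characterization. The witness exists because `X V_k = U_k D` with `D` invertible, by `k ≤ rank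
  -- X`.
  refine mul_pinv_eq_of_symm _ (Y := Matrix.diagonal (fun i => (D i)⁻¹) * Ukᵀ) ?_ ?_ ?_
  · simp [Matrix.transpose_mul]
  · rw [hX, Matrix.mul_assoc, ← Matrix.mul_assoc Ukᵀ, hUU, Matrix.one_mul]
  · rw [hX, Matrix.mul_assoc, ← Matrix.mul_assoc (Matrix.diagonal D),
      Matrix.diagonal_mul_diagonal]
    simp [hD]

/-- The entries of `U_{k+}ᵀ x` are the coordinates of `x - P x` along the later left singular
vectors, so this is Bessel's inequality. -/
theorem norm_UkPlus_transpose_le (k : ℕ) (x : EuclideanSpace ℝ m) :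
    ‖Matrix.toEuclideanLin (s.UkPlus k)ᵀ x‖ ≤ ‖x - s.proj k x‖ := by
  refine abs_le_of_sq_le_sq' ?_ (norm_nonneg _) |>.2
  refine le_trans ?_ (sum_inner_sq_le s.orthonormal_u (x - s.proj k x))
  rw [EuclideanSpace.norm_sq_eq]
  have : ∀ i, (inner ℝ (s.u i) (x - s.proj k x)) ^ 2 =
      if k ≤ i.val then (inner ℝ (s.u i) x) ^ 2 else 0 := by
    intro i
    rw [inner_sub_right, proj, inner_diagOp s.orthonormal_u]
    by_cases h : i.val < k
    · simp [h, h.not_ge]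
    · simp [h, not_lt.mp h]
  simp only [this]
  rw [← Finset.sum_filter, ← Finset.sum_subtype_eq_sum_filter, Finset.subtype_univ]
  refine le_of_eq (Finset.sum_congr rfl fun i _ => ?_)
  rw [Real.norm_eq_abs, sq_abs]
  simp [Matrix.toLpLin_apply, Matrix.mulVec, dotProduct, UkPlus, u, PiLp.inner_apply, mul_comm]

theorem proj_proj (k : ℕ) (x : EuclideanSpace ℝ m) : s.proj k (s.proj k x) = s.proj k x := by
  rw [proj, diagOp_diagOp s.orthonormal_u]
  congr 2; ext i; split_ifs <;> simp

theorem inner_proj_comm (k : ℕ) (x y : EuclideanSpace ℝ m) :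
    inner ℝ y (s.proj k x) = inner ℝ (s.proj k y) x := inner_diagOp_comm _ _ _ _

theorem proj_eq_apply {k : ℕ} (hk : k ≤ X.rank) (b : EuclideanSpace ℝ m) :
    ∃ y ∈ LinearMap.range (Matrix.toEuclideanLin (s.Vk k)),
      Matrix.toEuclideanLin X y = s.proj k b := by
  refine ⟨Matrix.toEuclideanLin (s.Vk k) (Matrix.toEuclideanLin (pinv (X * s.Vk k)) b),
    ⟨_, rfl⟩, ?_⟩
  rw [← s.mul_Vk_mul_pinv hk, toEuclideanLin_mul_apply, toEuclideanLin_mul_apply]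

theorem proj_apply_of_mem_range {k : ℕ} (hk : k ≤ X.rank) {y : EuclideanSpace ℝ n}
    (hy : y ∈ LinearMap.range (Matrix.toEuclideanLin (s.Vk k))) :
    s.proj k (Matrix.toEuclideanLin X y) = Matrix.toEuclideanLin X y := by
  obtain ⟨c, rfl⟩ := hy
  rw [← s.mul_Vk_mul_pinv hk, ← toEuclideanLin_mul_apply X, ← toEuclideanLin_mul_apply,
    mul_pinv_mul]

end ThinSVD

/-- The fitted vector of the principal component regression is the spectral projection. -/
theorem IsPCRSolution.apply_eq {n d k : ℕ} {A : Matrix (Fin n) (Fin d) ℝ} {s : ThinSVD A}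
    (hk : k ≤ A.rank) {b : EuclideanSpace ℝ (Fin n)} {x : EuclideanSpace ℝ (Fin d)}
    (h : IsPCRSolution s k b x) : Matrix.toEuclideanLin A x = s.proj k b := by
  obtain ⟨y, hy, hyb⟩ := s.proj_eq_apply hk b
  have h1 := h.2 y hy
  rw [hyb] at h1
  have h2 := s.proj_apply_of_mem_range hk h.1
  -- `A x - P b` lies in the range of `P` and `P b - b` in its kernel. Pythagoras then makes `P b`
  -- the only closest attainable point.
  have h3 : inner ℝ (Matrix.toEuclideanLin A x - s.proj k b) (s.proj k b - b) = 0 := by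
    rw [← h2, ← map_sub, ← s.inner_proj_comm, map_sub, s.proj_proj, sub_self, inner_zero_right]
  have h4 : ‖Matrix.toEuclideanLin A x - b‖ ^ 2 =
      ‖Matrix.toEuclideanLin A x - s.proj k b‖ ^ 2 + ‖s.proj k b - b‖ ^ 2 := by
    rw [← sub_add_sub_cancel _ (s.proj k b) b, norm_add_sq_real, h3]
    ring
  have h5 : ‖Matrix.toEuclideanLin A x - s.proj k b‖ ^ 2 ≤ 0 := by
    have := pow_le_pow_left₀ (norm_nonneg _) h1 2
    linarith
  rw [← sub_eq_zero, ← norm_eq_zero]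
  exact pow_eq_zero_iff two_ne_zero |>.mp (h5.antisymm (sq_nonneg _))

end SketchedPCR

namespace SketchedPCR

/-! ### Perturbation of spectral projections -/

section Perturbation

variable {m n n' : Type*} [Fintype m] [DecidableEq m] [Fintype n] [DecidableEq n]
  [Fintype n'] [DecidableEq n']

theorem norm_sq_transpose_eq_inner (X : Matrix m n ℝ) (x : EuclideanSpace ℝ m) :
    ‖Matrix.toEuclideanLin Xᵀ x‖ ^ 2 = inner ℝ x (Matrix.toEuclideanLin (X * Xᵀ) x) := by
  rw [toEuclideanLin_mul_apply, ← inner_toEuclideanLin_transpose, real_inner_self_eq_norm_sq]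

theorem sigma_sq_le_of_gram {X : Matrix m n ℝ} {Y : Matrix m n' ℝ} {e : ℝ} (he : 0 ≤ e)
    (hd : ∀ x, ‖Matrix.toEuclideanLin (X * Xᵀ) x - Matrix.toEuclideanLin (Y * Yᵀ) x‖ ≤ e * ‖x‖)
    {k : ℕ} (hk : 1 ≤ k) : sigma X k ^ 2 ≤ sigma Y k ^ 2 + e := by
  refine sigma_sq_le X Y he (fun x => ?_) hk
  rw [norm_sq_transpose_eq_inner, norm_sq_transpose_eq_inner, ← sub_le_iff_le_add',
    ← inner_sub_right]
  calc _ ≤ ‖x‖ * (e * ‖x‖) :=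
        (real_inner_le_norm _ _).trans (mul_le_mul_of_nonneg_left (hd x) (norm_nonneg _))
    _ = _ := by ring

theorem norm_proj_sub_proj_proj_le {X : Matrix m n ℝ} {Y : Matrix m n' ℝ} (s : ThinSVD X)
    (r : ThinSVD Y) {e : ℝ}
    (hd : ∀ x, ‖Matrix.toEuclideanLin (X * Xᵀ) x - Matrix.toEuclideanLin (Y * Yᵀ) x‖ ≤ e * ‖x‖)
    {k : ℕ} (hX : 0 < sigma X k) (x : EuclideanSpace ℝ m) :
    (sigma X k ^ 2 - sigma Y (k + 1) ^ 2) * ‖s.proj k x - r.proj k (s.proj k x)‖ ≤ e * ‖x‖ := by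
  refine norm_compl_spectral_le s.orthonormal_u r.orthonormal_u
    (φ := fun i => sigma X (i.val + 1) ^ 2) (ψ := fun i => sigma Y (i.val + 1) ^ 2)
    (by positivity) (sq_nonneg _) ?_ ?_ ?_ x
  · intro i hi
    exact pow_le_pow_left₀ hX.le (sigma_anti X hi) 2
  · intro j hj
    rw [abs_of_nonneg (sq_nonneg _)]
    exact pow_le_pow_left₀ (sigma_nonneg _ _)
      (sigma_anti Y (Nat.succ_le_succ (not_lt.mp hj))) 2
  · intro x
    rw [← s.mul_transpose_apply, ← r.mul_transpose_apply]
    exact hd x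

/-- `P - Q = (1-Q)P - Q(1-P)`, where the two terms have orthogonal ranges and act on the orthogonal
parts `P x` and `z = x - P x`. The second term is the adjoint of `(1-P)Q`, so `h2` bounds it through
duality. -/
theorem norm_proj_sub_proj_le {X : Matrix m n ℝ} {Y : Matrix m n' ℝ} (s : ThinSVD X)
    (r : ThinSVD Y) {k : ℕ} {ν : ℝ} (hν : 0 ≤ ν)
    (h1 : ∀ x, ‖s.proj k x - r.proj k (s.proj k x)‖ ≤ ν * ‖x‖)
    (h2 : ∀ x, ‖r.proj k x - s.proj k (r.proj k x)‖ ≤ ν * ‖x‖) (x : EuclideanSpace ℝ m) :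
    ‖s.proj k x - r.proj k x‖ ≤ ν * ‖x‖ := by
  set P := s.proj k with hP
  set Q := r.proj k with hQ
  set z := x - P x with hz
  have hPz : P z = 0 := by rw [hz, map_sub, s.proj_proj, sub_self]
  have hx : ‖x‖ ^ 2 = ‖P x‖ ^ 2 + ‖z‖ ^ 2 := by
    have h0 : inner ℝ (P x) z = 0 := by
      rw [← s.inner_proj_comm, ← hP, hPz, inner_zero_right]
    have : x = P x + z := by rw [hz]; abel
    conv_lhs => rw [this]
    rw [norm_add_sq_real, h0]; ring
  have ha : ‖P x - Q (P x)‖ ≤ ν * ‖P x‖ := by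
    have := h1 (P x)
    rwa [s.proj_proj] at this
  have hb : ‖Q z‖ ≤ ν * ‖z‖ := by
    rcases (norm_nonneg (Q z)).eq_or_lt with h | h
    · rw [← h]; positivity
    refine le_of_mul_le_mul_right ?_ h
    have e1 : ‖Q z‖ * ‖Q z‖ = inner ℝ (Q z - P (Q z)) z := by
      rw [inner_sub_left, ← s.inner_proj_comm, ← hP, hPz, inner_zero_right, sub_zero,
        ← real_inner_self_eq_norm_mul_norm, r.inner_proj_comm, r.proj_proj]
    have e2 := h2 (Q z)
    rw [r.proj_proj] at e2
    calc ‖Q z‖ * ‖Q z‖ ≤ (ν * ‖Q z‖) * ‖z‖ := by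
          rw [e1]
          exact (real_inner_le_norm _ _).trans (mul_le_mul_of_nonneg_right e2 (norm_nonneg _))
      _ = _ := by ring
  have hsq : ‖P x - Q x‖ ^ 2 = ‖P x - Q (P x)‖ ^ 2 + ‖Q z‖ ^ 2 := by
    have h0 : inner ℝ (P x - Q (P x)) (Q z) = 0 := by
      rw [r.inner_proj_comm, map_sub, ← hQ, hQ, r.proj_proj, sub_self, inner_zero_left]
    have : P x - Q x = (P x - Q (P x)) - Q z := by rw [hz, map_sub]; abel
    rw [this, norm_sub_sq_real, h0]; ring
  refine abs_le_of_sq_le_sq' ?_ (by positivity) |>.2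
  rw [hsq, mul_pow, hx]
  have := pow_le_pow_left₀ (norm_nonneg _) ha 2
  have := pow_le_pow_left₀ (norm_nonneg _) hb 2
  nlinarith

end Perturbation

/-! ### Deterministic guarantee under a close Gram matrix -/

section Deterministic

variable {n d t k : ℕ} {A : Matrix (Fin n) (Fin d) ℝ}

theorem sigma_one_sq_mul_gap (hk : 1 ≤ k) (hr : k ≤ A.rank) :
    gap A k * sigma A 1 ^ 2 = sigma A k ^ 2 - sigma A (k + 1) ^ 2 := by
  have : 0 < sigma A 1 := (sigma_pos_iff A le_rfl).mpr (hk.trans hr)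
  rw [gap, div_mul_cancel₀ _ (by positivity)]

theorem gap_pos (hk : 1 ≤ k) (hr : k ≤ A.rank) (hgap : sigma A (k + 1) < sigma A k) :
    0 < gap A k := by
  have : 0 < sigma A 1 := (sigma_pos_iff A le_rfl).mpr (hk.trans hr)
  refine div_pos ?_ (by positivity)
  nlinarith [sigma_nonneg A (k + 1)]

theorem gap_le_one (hk : 1 ≤ k) (hr : k ≤ A.rank) : gap A k ≤ 1 := by
  have : 0 < sigma A 1 := (sigma_pos_iff A le_rfl).mpr (hk.trans hr)
  rw [gap, div_le_one (by positivity)]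
  have := pow_le_pow_left₀ (sigma_nonneg A k) (sigma_anti A hk) 2
  nlinarith [sq_nonneg (sigma A (k + 1))]

/-- Spectral projections of rank `k` of `A` and of a sketch `H` with a close Gram matrix. -/
theorem proj_close_of_gram (sA : ThinSVD A) {H : Matrix (Fin n) (Fin t) ℝ} (s : ThinSVD H)
    (hk : 1 ≤ k) (hr : k ≤ A.rank) (hgap : sigma A (k + 1) < sigma A k) {ν : ℝ} (hν : 0 < ν)
    (h : specNorm (H * Hᵀ - A * Aᵀ) ≤ ν / (1 + ν) * gap A k * specNorm A ^ 2) :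
    k ≤ H.rank ∧ (∀ x, ‖s.proj k x - sA.proj k (s.proj k x)‖ ≤ ν * ‖x‖) ∧
      ∀ x, ‖s.proj k x - sA.proj k x‖ ≤ ν * ‖x‖ := by
  set D := sigma A k ^ 2 - sigma A (k + 1) ^ 2 with hD
  have hD0 : 0 < D := by
    have := sigma_nonneg A (k + 1)
    nlinarith
  set e := ν / (1 + ν) * D with he
  have heD : D - e = (1 / (1 + ν)) * D := by rw [he]; field_simp; ring
  -- The factor `ν/(1+ν)` is chosen so that the sin Θ quotient `e/(D-e)` is exactly `ν`.
  have he2 : ν * (D - e) = e := by rw [heD, he]; ring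
  have hDe : 0 < D - e := by rw [heD]; positivity
  have he0 : 0 ≤ e := by positivity
  have h' : specNorm (H * Hᵀ - A * Aᵀ) ≤ e := by
    rwa [specNorm_eq_sigma_one A, mul_assoc, sigma_one_sq_mul_gap hk hr] at h
  have hd : ∀ x, ‖Matrix.toEuclideanLin (H * Hᵀ) x - Matrix.toEuclideanLin (A * Aᵀ) x‖
      ≤ e * ‖x‖ := by
    intro x
    rw [← LinearMap.sub_apply, ← map_sub]
    exact (norm_apply_le_specNorm _ x).trans (mul_le_mul_of_nonneg_right h' (norm_nonneg _))
  have hd' : ∀ x, ‖Matrix.toEuclideanLin (A * Aᵀ) x - Matrix.toEuclideanLin (H * Hᵀ) x‖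
      ≤ e * ‖x‖ := fun x => by rw [norm_sub_rev]; exact hd x
  have hA : 0 < sigma A k := (sigma_nonneg A (k + 1)).trans_lt hgap
  have w1 := sigma_sq_le_of_gram he0 hd' hk
  have w2 := sigma_sq_le_of_gram he0 hd (Nat.succ_le_succ (Nat.zero_le k))
  -- Otherwise Weyl's inequality gives `σ_k(A)² ≤ e < D ≤ σ_k(A)²`.
  have hH : 0 < sigma H k := by
    refine (sigma_nonneg H k).lt_of_ne fun h0 => ?_
    rw [← h0] at w1
    nlinarith [sq_nonneg (sigma A (k + 1))]
  have aux : ∀ {a b : ℝ}, 0 ≤ a → ∀ {c}, D - e ≤ c → c * a ≤ e * b → a ≤ ν * b := by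
    intro a b ha c hc hab
    have : (D - e) * a ≤ (D - e) * (ν * b) := by
      calc (D - e) * a ≤ c * a := by gcongr
        _ ≤ e * b := hab
        _ = (ν * (D - e)) * b := by rw [he2]
        _ = _ := by ring
    exact le_of_mul_le_mul_left this hDe
  -- Here the gap is `σ_k(H)² - σ_{k+1}(A)²`, at least `D - e` by `w1`; in `c2` it is `σ_k(A)² -
  -- σ_{k+1}(H)²`, at least `D - e` by `w2`.
  have c1 : ∀ x, ‖s.proj k x - sA.proj k (s.proj k x)‖ ≤ ν * ‖x‖ := fun x =>
    aux (norm_nonneg _) (by linarith) (norm_proj_sub_proj_proj_le s sA hd hH x)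
  have c2 : ∀ x, ‖sA.proj k x - s.proj k (sA.proj k x)‖ ≤ ν * ‖x‖ := fun x =>
    aux (norm_nonneg _) (by linarith) (norm_proj_sub_proj_proj_le sA s hd' hA x)
  exact ⟨(sigma_pos_iff H hk).mp hH, c1, norm_proj_sub_proj_le s sA hν.le c1 c2⟩

theorem apply_compressedPCR (R : Matrix (Fin d) (Fin t) ℝ) (s : ThinSVD (A * R))
    (hk : k ≤ (A * R).rank) (b : EuclideanSpace ℝ (Fin n)) :
    Matrix.toEuclideanLin A (compressedPCR A R s k b) = s.proj k b := by
  rw [compressedPCR, ← toEuclideanLin_mul_apply, ← s.mul_Vk_mul_pinv hk]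
  simp only [Matrix.mul_assoc]

end Deterministic

/-! ### Mean square errors and the optimal predictor -/

section Risk

variable {n d : ℕ} {Ω : Type*} [MeasurableSpace Ω] {μ : Measure Ω} [IsProbabilityMeasure μ]
  {ξ : Fin n → Ω → ℝ} {σ : ℝ}

/-- The mean square of a linear functional of the noise. -/
theorem IsNoise.integral_sq_sum (h : IsNoise μ ξ σ) (c : Fin n → ℝ) :
    ∫ ω, (∑ i, c i * ξ i ω) ^ 2 ∂μ = σ ^ 2 * ∑ i, c i ^ 2 := by
  have hm : ∀ i, MemLp (fun ω => c i * ξ i ω) 2 μ := fun i => (h.memLp i).const_mul (c i)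
  have h0 : ∫ ω, (∑ i, c i * ξ i ω) ∂μ = 0 := by
    rw [integral_finsetSum _ fun i _ => (hm i).integrable one_le_two]
    simp [integral_const_mul, h.mean]
  have hind : iIndepFun (fun i ω => c i * ξ i ω) μ :=
    h.indep.comp (fun i x => c i * x) fun i => by fun_prop
  have h1 := IndepFun.variance_sum (X := fun i ω => c i * ξ i ω) (s := Finset.univ)
    (fun i _ => hm i) (fun i _ j _ hij => hind.indepFun hij)
  have h2 : (∑ i, fun ω => c i * ξ i ω) = fun ω => ∑ i, c i * ξ i ω := by
    ext ω; simp
  rw [h2, variance_of_integral_eq_zero (Finset.aemeasurable_fun_sum _ fun i _ =>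
    (hm i).aestronglyMeasurable.aemeasurable) h0] at h1
  rw [h1, Finset.mul_sum]
  refine Finset.sum_congr rfl fun i _ => ?_
  rw [variance_const_mul, h.variance]
  ring

theorem IsNoise.integral_sq_affine (h : IsNoise μ ξ σ) (a : ℝ) (c : Fin n → ℝ) :
    Integrable (fun ω => (a + ∑ i, c i * ξ i ω) ^ 2) μ ∧
    ∫ ω, (a + ∑ i, c i * ξ i ω) ^ 2 ∂μ = a ^ 2 + σ ^ 2 * ∑ i, c i ^ 2 := by
  have hm : MemLp (fun ω => ∑ i, c i * ξ i ω) 2 μ :=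
    memLp_finsetSum _ fun i _ => (h.memLp i).const_mul (c i)
  have hi := hm.integrable one_le_two
  have h0 : ∫ ω, (∑ i, c i * ξ i ω) ∂μ = 0 := by
    rw [integral_finsetSum _ fun i _ => ((h.memLp i).const_mul (c i)).integrable one_le_two]
    simp [integral_const_mul, h.mean]
  have hint : Integrable (fun ω => a ^ 2 + 2 * a * ∑ i, c i * ξ i ω) μ :=
    (integrable_const _).add (hi.const_mul _)
  have heq : (fun ω => (a + ∑ i, c i * ξ i ω) ^ 2) =
      fun ω => (a ^ 2 + 2 * a * ∑ i, c i * ξ i ω) + (∑ i, c i * ξ i ω) ^ 2 := by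
    ext ω; ring
  rw [heq]
  refine ⟨hint.add hm.integrable_sq, ?_⟩
  rw [integral_add hint hm.integrable_sq, h.integral_sq_sum, integral_add (integrable_const _)
    (hi.const_mul _), integral_const_mul, h0]
  simp

/-- The mean square error of the affine estimator `∑ ⟪u i, b⟫ u i` of `g`, for `b = f + ξ`. -/
theorem IsNoise.integral_norm_sq_diagOp {ι : Type*} [Fintype ι] (h : IsNoise μ ξ σ)
    {u : ι → EuclideanSpace ℝ (Fin n)} (hu : Orthonormal ℝ u) (φ : ι → ℝ)
    (f g : EuclideanSpace ℝ (Fin n)) :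
    ∫ ω, ‖diagOp u φ (response f ξ ω) - g‖ ^ 2 / n ∂μ =
      (‖diagOp u φ f - g‖ ^ 2 + σ ^ 2 * ∑ i, φ i ^ 2) / n := by
  have hcoord : ∀ a ω, (diagOp u φ (response f ξ ω) - g) a =
      (diagOp u φ f - g) a + ∑ i, (∑ j, φ j * u j i * u j a) * ξ i ω := by
    intro a ω
    rw [response, map_add, diagOp_apply u φ (WithLp.toLp 2 fun i => ξ i ω)]
    simp only [PiLp.inner_apply, PiLp.add_apply, PiLp.sub_apply, WithLp.ofLp_sum,
      Finset.sum_apply, WithLp.ofLp_smul, Pi.smul_apply, smul_eq_mul, RCLike.inner_apply,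
      conj_trivial]
    simp only [Finset.sum_mul, Finset.mul_sum]
    rw [Finset.sum_comm, add_sub_right_comm]
    congr 1
    exact Finset.sum_congr rfl fun _ _ => Finset.sum_congr rfl fun _ _ => by ring
  have hA := fun a => h.integral_sq_affine ((diagOp u φ f - g) a)
    (fun i => ∑ j, φ j * u j i * u j a)
  simp only [EuclideanSpace.norm_sq_eq, Real.norm_eq_abs, sq_abs, hcoord]
  rw [integral_div, integral_finsetSum _ fun a _ => (hA a).1]
  congr 1
  simp only [(hA _).2]
  rw [Finset.sum_add_distrib, ← Finset.mul_sum]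
  congr 2
  -- The variance is the squared Frobenius norm of the diagonal operator, computed from the images
  -- of the standard basis vectors.
  calc ∑ a, ∑ i, (∑ j, φ j * u j i * u j a) ^ 2
      = ∑ a, ‖diagOp u φ (EuclideanSpace.single a 1)‖ ^ 2 := by
        refine Finset.sum_congr rfl fun a _ => ?_
        rw [diagOp_apply, EuclideanSpace.norm_sq_eq]
        refine Finset.sum_congr rfl fun i _ => ?_
        rw [Real.norm_eq_abs, sq_abs]
        congr 1
        simp only [WithLp.ofLp_sum, Finset.sum_apply, WithLp.ofLp_smul, Pi.smul_apply,
          smul_eq_mul, EuclideanSpace.inner_single_right, one_mul, conj_trivial]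
        exact Finset.sum_congr rfl fun _ _ => by ring
    _ = ∑ i, φ i ^ 2 := by
        simp only [norm_sq_diagOp hu]
        rw [Finset.sum_comm]
        refine Finset.sum_congr rfl fun j _ => ?_
        simp only [mul_pow]
        rw [← Finset.mul_sum]
        have := hu.norm_eq_one j
        have h2 : ‖u j‖ ^ 2 = 1 := by rw [this]; norm_num
        rw [EuclideanSpace.norm_sq_eq] at h2
        simp only [Real.norm_eq_abs, sq_abs] at h2
        simp [EuclideanSpace.inner_single_right, h2]

/-- The optimal predictor satisfies the normal equations for the mean response. -/
theorem IsOptimalPredictor.inner_eq_zero (h : IsNoise μ ξ σ) {f : EuclideanSpace ℝ (Fin n)}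
    {A : Matrix (Fin n) (Fin d) ℝ} {xstar : EuclideanSpace ℝ (Fin d)}
    (hx : IsOptimalPredictor μ ξ f A xstar) (y : EuclideanSpace ℝ (Fin d)) :
    inner ℝ (Matrix.toEuclideanLin A y) (Matrix.toEuclideanLin A xstar - f) = 0 := by
  -- Dividing by `n = 0` would make every risk zero and minimality empty; in that case all vectors
  -- vanish.
  rcases Nat.eq_zero_or_pos n with rfl | hn
  · simp [PiLp.inner_apply]
  have hrisk : ∀ x, predictionRisk μ ξ f A x =
      (‖Matrix.toEuclideanLin A x - f‖ ^ 2 + σ ^ 2 * n) / n := by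
    intro x
    have := h.integral_norm_sq_diagOp (EuclideanSpace.basisFun (Fin n) ℝ).orthonormal
      (fun _ => 1) f (Matrix.toEuclideanLin A x)
    have hid : ∀ b, diagOp (EuclideanSpace.basisFun (Fin n) ℝ) (fun _ => (1 : ℝ)) b = b := by
      intro b
      rw [diagOp_apply]
      simpa using (EuclideanSpace.basisFun (Fin n) ℝ).sum_repr' b
    simp only [hid] at this
    rw [predictionRisk]
    simp only [norm_sub_rev (Matrix.toEuclideanLin A x)]
    rw [this]
    simp
  have hmin : ∀ z, ‖Matrix.toEuclideanLin A xstar - f‖ ^ 2 ≤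
      ‖Matrix.toEuclideanLin A z - f‖ ^ 2 := by
    intro z
    have := hx.1 z
    rw [hrisk, hrisk, div_le_div_iff_of_pos_right (by exact_mod_cast hn)] at this
    linarith
  set g := Matrix.toEuclideanLin A xstar - f
  set w := Matrix.toEuclideanLin A y
  have hq : ∀ c : ℝ, 0 ≤ 2 * c * inner ℝ w g + c ^ 2 * ‖w‖ ^ 2 := by
    intro c
    have := hmin (xstar + c • y)
    rw [map_add, map_smul, add_sub_right_comm, norm_add_sq_real, inner_smul_right, norm_smul,
      mul_pow, real_inner_comm] at this
    simp only [Real.norm_eq_abs, sq_abs] at this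
    change ‖g‖ ^ 2 ≤ ‖g‖ ^ 2 + 2 * (c * inner ℝ w g) + c ^ 2 * ‖w‖ ^ 2 at this
    linarith
  by_contra hne
  -- The near-minimizer of the quadratic in `c`; the `+ 1` in the denominator avoids treating `w =
  -- 0` separately.
  have := hq (-(inner ℝ w g) / (‖w‖ ^ 2 + 1))
  have h2 : 0 < (inner ℝ w g) ^ 2 := by positivity
  have h3 : 2 * (-(inner ℝ w g) / (‖w‖ ^ 2 + 1)) * inner ℝ w g +
      (-(inner ℝ w g) / (‖w‖ ^ 2 + 1)) ^ 2 * ‖w‖ ^ 2 =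
      -((inner ℝ w g) ^ 2 * (‖w‖ ^ 2 + 2)) / (‖w‖ ^ 2 + 1) ^ 2 := by
    field_simp; ring
  rw [h3] at this
  have h4 : -((inner ℝ w g) ^ 2 * (‖w‖ ^ 2 + 2)) / (‖w‖ ^ 2 + 1) ^ 2 < 0 :=
    div_neg_of_neg_of_pos (by nlinarith [sq_nonneg ‖w‖, mul_nonneg h2.le (sq_nonneg ‖w‖)])
      (by positivity)
  linarith

end Risk

end SketchedPCR

namespace SketchedPCR

/-! ### Excess risk of the compressed regression -/

theorem sum_indicator_sq {r k : ℕ} (h : k ≤ r) :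
    ∑ i : Fin r, (if i ∈ {i : Fin r | i.val < k} then (1 : ℝ) else 0) ^ 2 = k := by
  simp only [ite_pow, one_pow, ne_eq, OfNat.ofNat_ne_zero, not_false_eq_true, zero_pow,
    Set.mem_ofPred_eq]
  rw [Finset.sum_boole]
  simp [Fin.card_filter_val_lt, h]

/-- The excess risk of an estimator whose fitted vector is a spectral projection. -/
theorem excessRisk_eq {n d k : ℕ} {p : Type*} [Fintype p] [DecidableEq p]
    {Ω : Type*} [MeasurableSpace Ω] {μ : Measure Ω}
    [IsProbabilityMeasure μ] {ξ : Fin n → Ω → ℝ} {σ : ℝ} (h : IsNoise μ ξ σ)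
    {X : Matrix (Fin n) p ℝ} (s : ThinSVD X) (hk : k ≤ X.rank) (A : Matrix (Fin n) (Fin d) ℝ)
    (f : EuclideanSpace ℝ (Fin n)) (xstar : EuclideanSpace ℝ (Fin d))
    {θ : EuclideanSpace ℝ (Fin n) → EuclideanSpace ℝ (Fin d)}
    (hθ : ∀ b, Matrix.toEuclideanLin A (θ b) = s.proj k b) :
    excessRisk μ ξ f A xstar θ =
      (‖s.proj k f - Matrix.toEuclideanLin A xstar‖ ^ 2 + σ ^ 2 * k) / n := by
  rw [excessRisk]
  simp only [hθ, ThinSVD.proj]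
  rw [h.integral_norm_sq_diagOp s.orthonormal_u, sum_indicator_sq (hk.trans (rank_le_min X))]

/-- The residual `f - A x` is orthogonal to the range of `A`, hence killed by `P`. With `g = A x`
this gives `P f = P g`, so `‖P g - g‖ ≤ ‖g‖ ≤ ‖f‖`. -/
theorem norm_proj_sub_optimal_le {n d k : ℕ} {A : Matrix (Fin n) (Fin d) ℝ} (s : ThinSVD A)
    (hk : k ≤ A.rank) {f : EuclideanSpace ℝ (Fin n)} {x : EuclideanSpace ℝ (Fin d)}
    (hx : ∀ y, inner ℝ (Matrix.toEuclideanLin A y) (Matrix.toEuclideanLin A x - f) = 0) :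
    ‖s.proj k f - Matrix.toEuclideanLin A x‖ ≤ ‖f‖ := by
  set g := Matrix.toEuclideanLin A x with hg
  have h1 : s.proj k (g - f) = 0 := by
    rw [← norm_eq_zero, ← pow_eq_zero_iff two_ne_zero, ← real_inner_self_eq_norm_sq,
      s.inner_proj_comm, s.proj_proj]
    obtain ⟨y, -, hy⟩ := s.proj_eq_apply hk (g - f)
    rw [← hy]
    exact hx y
  have h2 : s.proj k f = s.proj k g := by
    rw [map_sub, sub_eq_zero] at h1
    exact h1.symm
  have h3 : ‖g‖ ≤ ‖f‖ := by
    refine abs_le_of_sq_le_sq' ?_ (norm_nonneg _) |>.2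
    have : f = g - (g - f) := by abel
    conv_rhs => rw [this]
    rw [norm_sub_sq_real, hg, hx x]
    nlinarith [sq_nonneg ‖g - f‖]
  rw [h2, norm_sub_rev]
  exact (norm_sub_diagOp_indicator_le s.orthonormal_u _ g).trans h3

/-- A sketch with a close Gram matrix gives approximate principal component projections and
a small excess risk. -/
theorem compressedPCR_guarantee {n d t k : ℕ} {A : Matrix (Fin n) (Fin d) ℝ} (sA : ThinSVD A)
    (hk : 1 ≤ k) (hr : k ≤ A.rank) (hgap : sigma A (k + 1) < sigma A k) {ν : ℝ} (hν : 0 < ν)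
    {G : Matrix (Fin t) (Fin d) ℝ}
    (hG : specNorm (A * Gᵀ * (A * Gᵀ)ᵀ - A * Aᵀ) ≤ ν / (1 + ν) * gap A k * specNorm A ^ 2)
    {Ω : Type*} [MeasurableSpace Ω] {μ : Measure Ω} [IsProbabilityMeasure μ]
    {f : EuclideanSpace ℝ (Fin n)} {ξ : Fin n → Ω → ℝ} {σ : ℝ} (hξ : IsNoise μ ξ σ)
    {xstar : EuclideanSpace ℝ (Fin d)} (hx : IsOptimalPredictor μ ξ f A xstar)
    {xk : EuclideanSpace ℝ (Fin n) → EuclideanSpace ℝ (Fin d)}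
    (hxk : ∀ b, IsPCRSolution sA k b (xk b)) (s : ThinSVD (A * Gᵀ)) :
    (∀ b, IsApproxPCP sA k ν ν b
      (Matrix.toEuclideanLin A (compressedPCR A Gᵀ s k b))) ∧
    excessRisk μ ξ f A xstar (compressedPCR A Gᵀ s k) ≤
      excessRisk μ ξ f A xstar xk + (2 * ν + ν ^ 2) * ‖f‖ ^ 2 / n := by
  obtain ⟨hH, h1, h2⟩ := proj_close_of_gram sA s hk hr hgap hν hG
  have hc := apply_compressedPCR Gᵀ s hH
  have hq : ∀ b, Matrix.toEuclideanLin A (xk b) = sA.proj k b := fun b => (hxk b).apply_eq hr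
  refine ⟨fun b => ⟨⟨xk b, hxk b, ?_⟩, ?_⟩, ?_⟩
  · rw [hc, hq]
    refine (abs_norm_sub_norm_le _ _).trans ?_
    rw [sub_sub_sub_cancel_right]
    exact h2 b
  · rw [hc]
    exact (sA.norm_UkPlus_transpose_le k _).trans (h1 b)
  -- The two variance terms `σ² k` are equal; only the biases are compared, and `(ν‖f‖ + a)² ≤ a² +
  -- (2ν + ν²)‖f‖²` when `0 ≤ a ≤ ‖f‖`.
  · rw [excessRisk_eq hξ s hH A f xstar hc, excessRisk_eq hξ sA hr A f xstar hq, ← add_div]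
    refine div_le_div_of_nonneg_right ?_ (Nat.cast_nonneg n)
    have ha := norm_proj_sub_optimal_le sA hr (hx.inner_eq_zero hξ)
    have hb : ‖s.proj k f - Matrix.toEuclideanLin A xstar‖ ≤
        ν * ‖f‖ + ‖sA.proj k f - Matrix.toEuclideanLin A xstar‖ := by
      rw [← sub_add_sub_cancel _ (sA.proj k f)]
      exact (norm_add_le _ _).trans (add_le_add_left (h2 f) _)
    have hb2 := pow_le_pow_left₀ (norm_nonneg _) hb 2
    have hc2 := mul_le_mul_of_nonneg_left ha (mul_nonneg hν.le (norm_nonneg f))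
    nlinarith

end SketchedPCR

namespace SketchedPCR

/-! ### Frobenius bound and measurability of the error event -/

section Frobenius

variable {m n : Type*} [Fintype m] [DecidableEq m] [Fintype n] [DecidableEq n]

theorem specNorm_sq_le_sum_sq (X : Matrix m n ℝ) : specNorm X ^ 2 ≤ ∑ i, ∑ j, X i j ^ 2 := by
  have h0 : 0 ≤ ∑ i, ∑ j, X i j ^ 2 :=
    Finset.sum_nonneg fun _ _ => Finset.sum_nonneg fun _ _ => sq_nonneg _
  rw [← Real.sq_sqrt h0]
  refine pow_le_pow_left₀ (specNorm_nonneg X) (specNorm_le (Real.sqrt_nonneg _) fun x => ?_) 2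
  refine abs_le_of_sq_le_sq' ?_ (by positivity) |>.2
  rw [mul_pow, Real.sq_sqrt h0, EuclideanSpace.norm_sq_eq, EuclideanSpace.norm_sq_eq,
    Finset.sum_mul]
  refine Finset.sum_le_sum fun i _ => ?_
  simp only [Real.norm_eq_abs, sq_abs, Matrix.toLpLin_apply, Matrix.mulVec, dotProduct]
  exact Finset.sum_mul_sq_le_sq_mul_sq _ _ _

theorem continuous_specNorm : Continuous (specNorm : Matrix m n ℝ → ℝ) := by
  have : Continuous fun X : Matrix m n ℝ =>
      LinearMap.toContinuousLinearMap (Matrix.toEuclideanLin X) :=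
    LinearMap.continuous_of_finiteDimensional
      ((LinearMap.toContinuousLinearMap (𝕜 := ℝ)).toLinearMap ∘ₗ
        (Matrix.toEuclideanLin (𝕜 := ℝ) (m := m) (n := n)).toLinearMap)
  exact this.norm

theorem measurableSet_le_specNorm_gram {t : ℕ} {d n : ℕ} (X : Matrix (Fin d) (Fin n) ℝ) (c : ℝ) :
    MeasurableSet {S : Matrix (Fin t) (Fin d) ℝ |
      c ≤ specNorm (Xᵀ * Sᵀ * S * X - Xᵀ * X)} := by
  have h : Continuous fun S : Fin t → Fin d → ℝ =>
      specNorm (Xᵀ * (Matrix.of S)ᵀ * Matrix.of S * X - Xᵀ * X) := by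
    refine continuous_specNorm.comp ?_
    have : Continuous fun S : Fin t → Fin d → ℝ => (Matrix.of S : Matrix (Fin t) (Fin d) ℝ) :=
      continuous_id
    fun_prop
  exact measurableSet_le measurable_const h.measurable

end Frobenius

/-! ### CountSketch by second moments -/

section CountSketch

variable {t d : ℕ}

/-- The value of the sign bit. -/
def signValue (b : Bool) : ℝ := if b then 1 else -1

theorem signValue_not (b : Bool) : signValue (!b) = -signValue b := by
  cases b <;> simp [signValue]

theorem signValue_mul_self (b : Bool) : signValue b * signValue b = 1 := by
  cases b <;> simp [signValue]

/-- The off-diagonal entries of the Gram matrix of a CountSketch matrix. -/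
def collision (ω : Fin d → Fin t × Bool) (p : Fin d × Fin d) : ℝ :=
  if p.1 ≠ p.2 ∧ (ω p.1).1 = (ω p.2).1 then
    signValue (ω p.1).2 * signValue (ω p.2).2 else 0

/-- The law of the hash values and signs of a CountSketch matrix. -/
noncomputable def hashMeasure (t d : ℕ) : Measure (Fin d → Fin t × Bool) :=
  Measure.pi (fun _ => uniformOn Set.univ)

variable [NeZero t]

instance : IsProbabilityMeasure (uniformOn (Set.univ : Set (Fin t × Bool))) :=
  isProbabilityMeasure_uniformOn Set.finite_univ Set.univ_nonempty

instance : IsProbabilityMeasure (hashMeasure t d) := by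
  unfold hashMeasure; infer_instance

theorem hashMeasure_real_singleton (ω : Fin d → Fin t × Bool) :
    (hashMeasure t d).real {ω} = ((t : ℝ) * 2)⁻¹ ^ d := by
  rw [Measure.real, hashMeasure, Measure.pi_singleton]
  simp [uniformOn_univ, ENNReal.toReal_inv]

theorem integral_hashMeasure (F : (Fin d → Fin t × Bool) → ℝ) :
    ∫ ω, F ω ∂(hashMeasure t d) = ((t : ℝ) * 2)⁻¹ ^ d * ∑ ω, F ω := by
  rw [integral_fintype Integrable.of_finite, Finset.mul_sum]
  simp [hashMeasure_real_singleton]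

/-- The law is uniform on a finite set, so every permutation preserves it. The symmetries used are a
sign flip and a cyclic shift of one hash value. -/
theorem integral_hashMeasure_comp (e : Equiv.Perm (Fin d → Fin t × Bool))
    (F : (Fin d → Fin t × Bool) → ℝ) :
    ∫ ω, F (e ω) ∂(hashMeasure t d) = ∫ ω, F ω ∂(hashMeasure t d) := by
  rw [integral_hashMeasure, integral_hashMeasure, Equiv.sum_comp e]

/-- Flip the sign of one column. -/
def flipSign (j : Fin d) : Equiv.Perm (Fin d → Fin t × Bool) :=
  Function.Involutive.toPerm (fun ω => Function.update ω j ((ω j).1, !(ω j).2)) fun ω => by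
    simp

/-- Shift the hash value of one column. -/
def shiftHash (j : Fin d) (r : Fin t) : Equiv.Perm (Fin d → Fin t × Bool) where
  toFun ω := Function.update ω j ((ω j).1 + r, (ω j).2)
  invFun ω := Function.update ω j ((ω j).1 - r, (ω j).2)
  left_inv ω := by simp
  right_inv ω := by simp

theorem flipSign_apply (j : Fin d) (ω : Fin d → Fin t × Bool) :
    flipSign j ω = Function.update ω j ((ω j).1, !(ω j).2) := rfl

theorem collision_flipSign (j : Fin d) (ω : Fin d → Fin t × Bool) (p : Fin d × Fin d) :
    collision (flipSign j ω) p =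
      if p.1 = j ∨ p.2 = j then -collision ω p else collision ω p := by
  obtain ⟨a, b⟩ := p
  by_cases hab : a = b
  · simp [collision, hab]
  by_cases ha : a = j
  · subst ha
    simp [collision, flipSign_apply, Ne.symm hab, signValue_not, hab]
    split_ifs <;> simp
  · by_cases hb : b = j
    · subst hb
      simp [collision, flipSign_apply, signValue_not, hab]
      split_ifs <;> simp
    · simp [collision, flipSign_apply, ha, hb]

/-- Flipping the sign of a column that occurs in `p` but not in `q` negates the integrand. -/
theorem integral_collision_mul_eq_zero {j : Fin d} {p q : Fin d × Fin d}
    (hp : p.1 = j ∨ p.2 = j) (hq : ¬ (q.1 = j ∨ q.2 = j)) :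
    ∫ ω, collision ω p * collision ω q ∂(hashMeasure t d) = 0 := by
  have h := integral_hashMeasure_comp (t := t) (flipSign j)
    (fun ω => collision ω p * collision ω q)
  simp only [collision_flipSign, if_pos hp, if_neg hq, neg_mul, integral_neg] at h
  linarith

/-- Among the `t` cyclic shifts of the hash of `p.1` exactly one collides with the hash of `p.2`,
and all shifts have the same expectation. -/
theorem integral_collision_sq {p : Fin d × Fin d} (hp : p.1 ≠ p.2) :
    ∫ ω, collision ω p * collision ω p ∂(hashMeasure t d) = (t : ℝ)⁻¹ := by
  have h1 : ∀ ω : Fin d → Fin t × Bool, collision ω p * collision ω p =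
      if (ω p.1).1 = (ω p.2).1 then 1 else 0 := by
    intro ω
    simp only [collision, hp, ne_eq, not_false_eq_true, true_and]
    split_ifs
    · rw [mul_mul_mul_comm, signValue_mul_self, signValue_mul_self, one_mul]
    · simp
  simp only [h1]
  set F : (Fin d → Fin t × Bool) → ℝ := fun ω => if (ω p.1).1 = (ω p.2).1 then 1 else 0
  have h2 : ∑ r : Fin t, ∫ ω, F (shiftHash p.1 r ω) ∂(hashMeasure t d) = 1 := by
    rw [← integral_finsetSum _ fun _ _ => Integrable.of_finite]
    have : ∀ ω : Fin d → Fin t × Bool, ∑ r : Fin t, F (shiftHash p.1 r ω) = 1 := by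
      intro ω
      have : ∀ r, F (shiftHash p.1 r ω) = if r = (ω p.2).1 - (ω p.1).1 then 1 else 0 := by
        intro r
        simp [F, shiftHash, Function.update_of_ne hp.symm, eq_sub_iff_add_eq']
      simp [this]
    simp [this]
  simp only [integral_hashMeasure_comp] at h2
  rw [Finset.sum_const, Finset.card_univ, Fintype.card_fin, nsmul_eq_mul] at h2
  exact eq_inv_of_mul_eq_one_right h2

theorem integral_collision_mul (p q : Fin d × Fin d) :
    ∫ ω, collision ω p * collision ω q ∂(hashMeasure t d) =
      if p.1 ≠ p.2 then (t : ℝ)⁻¹ * ((if q = p then 1 else 0) + if q = p.swap then 1 else 0)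
        else 0 := by
  split_ifs with hp h1 h2 h2
  · subst h1; exact absurd (congrArg Prod.fst h2) hp
  · rw [h1, integral_collision_sq hp]; ring
  · subst h2
    have : ∀ ω : Fin d → Fin t × Bool, collision ω p.swap = collision ω p := by
      intro ω
      simp only [collision, Prod.fst_swap, Prod.snd_swap, ne_comm (a := p.2),
        eq_comm (a := (ω p.2).1), mul_comm]
    simp only [this]
    rw [integral_collision_sq hp]; ring
  · rw [add_zero, mul_zero]
    by_cases hq : q.1 = q.2
    · simp [collision, hq]
    -- If both columns of `p` occurred in `q`, then `q` would be `p` or its swap.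
    by_cases h3 : q.1 = p.1 ∨ q.2 = p.1
    · by_cases h4 : q.1 = p.2 ∨ q.2 = p.2
      · exfalso
        rcases h3 with h3 | h3 <;> rcases h4 with h4 | h4
        · exact hp (h3.symm.trans h4)
        · exact h1 (Prod.ext h3 h4)
        · exact h2 (Prod.ext h4 h3)
        · exact hp (h3.symm.trans h4)
      · exact integral_collision_mul_eq_zero (Or.inr rfl) h4
    · exact integral_collision_mul_eq_zero (Or.inl rfl) h3
  · simp [collision, hp]

/-- A collision correlates only with itself and its swap. The cross terms `c p * c p.swap` are
absorbed by AM–GM, whence the factor `2`. -/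
theorem integral_sq_sum_collision_le (c : Fin d × Fin d → ℝ) :
    ∫ ω, (∑ p, c p * collision ω p) ^ 2 ∂(hashMeasure t d) ≤ 2 / t * ∑ p, c p ^ 2 := by
  have h1 : ∀ ω : Fin d → Fin t × Bool, (∑ p, c p * collision ω p) ^ 2 =
      ∑ p, ∑ q, c p * c q * (collision ω p * collision ω q) := by
    intro ω
    rw [sq, Finset.sum_mul_sum]
    exact Finset.sum_congr rfl fun _ _ => Finset.sum_congr rfl fun _ _ => by ring
  simp only [h1]
  rw [integral_finsetSum _ fun _ _ => Integrable.of_finite]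
  have ht : (0 : ℝ) ≤ (t : ℝ)⁻¹ := by positivity
  calc ∑ p, ∫ ω, ∑ q, c p * c q * (collision ω p * collision ω q) ∂(hashMeasure t d)
      ≤ ∑ p, (t : ℝ)⁻¹ * (c p ^ 2 + (c p ^ 2 + c p.swap ^ 2) / 2) := by
        refine Finset.sum_le_sum fun p _ => ?_
        rw [integral_finsetSum _ fun _ _ => Integrable.of_finite]
        simp only [integral_const_mul, integral_collision_mul]
        split_ifs with hp
        · have : ∀ q, c p * c q * ((t : ℝ)⁻¹ * ((if q = p then 1 else 0) +
              if q = p.swap then 1 else 0)) = (t : ℝ)⁻¹ * c p *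
                ((if q = p then c q else 0) + if q = p.swap then c q else 0) := by
            intro q; split_ifs <;> ring
          simp only [this]
          rw [← Finset.mul_sum, Finset.sum_add_distrib]
          simp only [Finset.sum_ite_eq', Finset.mem_univ, if_true, mul_assoc]
          refine mul_le_mul_of_nonneg_left ?_ ht
          nlinarith [sq_nonneg (c p - c p.swap)]
        · simp only [mul_zero, Finset.sum_const_zero]
          positivity
    _ = _ := by
        have hs : ∑ p : Fin d × Fin d, c p.swap ^ 2 = ∑ p, c p ^ 2 :=
          Equiv.sum_comp (Equiv.prodComm _ _) (fun p => c p ^ 2)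
        rw [← Finset.mul_sum, Finset.sum_add_distrib, ← Finset.sum_div, Finset.sum_add_distrib, hs]
        ring

/-- The CountSketch matrix of given hash values and signs. -/
def hashMatrix (ω : Fin d → Fin t × Bool) : Matrix (Fin t) (Fin d) ℝ :=
  Matrix.of fun i j => if (ω j).1 = i then (if (ω j).2 then (1 : ℝ) else -1) else 0

theorem hashMatrix_gram (ω : Fin d → Fin t × Bool) :
    (hashMatrix ω)ᵀ * hashMatrix ω = 1 + Matrix.of fun j l => collision ω (j, l) := by
  ext j l
  simp only [Matrix.mul_apply, Matrix.transpose_apply, hashMatrix, Matrix.of_apply,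
    Matrix.add_apply, Matrix.one_apply, collision]
  rw [Finset.sum_eq_single (ω j).1]
  · by_cases h : j = l
    · subst h
      by_cases hb : (ω j).2 <;> simp [hb]
    · simp [h, signValue, eq_comm (a := (ω l).1)]
  · intro i _ hi
    simp [hi.symm]
  · simp

theorem integral_sum_sq_gram_le {n : ℕ} (A : Matrix (Fin n) (Fin d) ℝ) :
    ∫ ω, (∑ a, ∑ b, (Aᵀᵀ * (hashMatrix ω)ᵀ * hashMatrix ω * Aᵀ - Aᵀᵀ * Aᵀ) a b ^ 2)
      ∂(hashMeasure t d) ≤ 2 / t * (∑ a, ∑ j, A a j ^ 2) ^ 2 := by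
  have h1 : ∀ (ω : Fin d → Fin t × Bool) a b,
      (Aᵀᵀ * (hashMatrix ω)ᵀ * hashMatrix ω * Aᵀ - Aᵀᵀ * Aᵀ) a b =
        ∑ p : Fin d × Fin d, (A a p.1 * A b p.2) * collision ω p := by
    intro ω a b
    rw [Matrix.transpose_transpose, Matrix.mul_assoc A, hashMatrix_gram, Matrix.mul_add,
      Matrix.mul_one, Matrix.add_mul, add_sub_cancel_left, Fintype.sum_prod_type_right]
    simp only [Matrix.mul_apply, Matrix.of_apply, Matrix.transpose_apply, Finset.sum_mul]
    exact Finset.sum_congr rfl fun _ _ => Finset.sum_congr rfl fun _ _ => by ring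
  simp only [h1]
  rw [integral_finsetSum _ fun _ _ => Integrable.of_finite]
  calc _ ≤ ∑ a, ∑ b, 2 / (t : ℝ) * ∑ p : Fin d × Fin d, (A a p.1 * A b p.2) ^ 2 := by
        refine Finset.sum_le_sum fun a _ => ?_
        rw [integral_finsetSum _ fun _ _ => Integrable.of_finite]
        exact Finset.sum_le_sum fun b _ => integral_sq_sum_collision_le _
    _ = _ := by
        simp only [← Finset.mul_sum, Fintype.sum_prod_type, mul_pow]
        congr 1
        rw [sq, Finset.sum_mul_sum]
        exact Finset.sum_congr rfl fun _ _ => Finset.sum_congr rfl fun _ _ =>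
          (Finset.sum_mul ..).symm

/-- Markov's inequality for the squared Frobenius error, whose mean is at most `2 sr(A)² ‖A‖⁴ / t`.
-/
theorem approxGram_countSketch_of_le {n : ℕ} {A : Matrix (Fin n) (Fin d) ℝ} {ε δ : ℝ}
    (hA : 0 < specNorm A) (hε : 0 < ε) (hδ : 0 < δ)
    (ht : 2 * stableRank A ^ 2 / (ε ^ 2 * δ) ≤ t) : ApproxGram (countSketch t d) Aᵀ ε δ := by
  have hmeas : Measurable (hashMatrix : (Fin d → Fin t × Bool) → _) := measurable_of_finite _
  have hlaw : countSketch t d = (hashMeasure t d).map hashMatrix := rfl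
  refine ⟨hlaw ▸ Measure.isProbabilityMeasure_map hmeas.aemeasurable, ?_⟩
  rw [hlaw, Measure.map_apply hmeas (measurableSet_le_specNorm_gram _ _), specNorm_transpose]
  set F : (Fin d → Fin t × Bool) → ℝ := fun ω =>
    ∑ a, ∑ b, (Aᵀᵀ * (hashMatrix ω)ᵀ * hashMatrix ω * Aᵀ - Aᵀᵀ * Aᵀ) a b ^ 2 with hF
  set c := (ε * specNorm A ^ 2) ^ 2 with hc
  have hc0 : 0 < c := by positivity
  have h1 := mul_meas_ge_le_integral_of_nonneg (μ := hashMeasure t d) (f := F)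
    (Filter.Eventually.of_forall fun ω => Finset.sum_nonneg fun _ _ =>
      Finset.sum_nonneg fun _ _ => sq_nonneg _) Integrable.of_finite c
  have h2 := h1.trans (integral_sum_sq_gram_le A)
  have ht0 : (0 : ℝ) < t := by exact_mod_cast NeZero.pos t
  have hsr : (∑ a, ∑ j, A a j ^ 2) = stableRank A * specNorm A ^ 2 := by
    rw [stableRank, div_mul_cancel₀ _ (by positivity)]
  have h3 : 2 / t * (∑ a, ∑ j, A a j ^ 2) ^ 2 ≤ c * δ := by
    rw [div_le_iff₀ (by positivity)] at ht
    rw [hsr, hc, div_mul_eq_mul_div, div_le_iff₀ ht0]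
    have := mul_le_mul_of_nonneg_right ht (by positivity : 0 ≤ specNorm A ^ 4)
    calc 2 * (stableRank A * specNorm A ^ 2) ^ 2 = 2 * stableRank A ^ 2 * specNorm A ^ 4 := by ring
      _ ≤ _ := this
      _ = _ := by ring
  have h4 : (hashMeasure t d).real {ω | c ≤ F ω} ≤ δ :=
    le_of_mul_le_mul_left (h2.trans h3) hc0
  refine le_trans (measure_mono fun ω hω => ?_) (ENNReal.le_ofReal_iff_toReal_le
    (measure_ne_top _ _) hδ.le |>.mpr h4)
  exact (pow_le_pow_left₀ (by positivity) hω 2).trans (specNorm_sq_le_sum_sq _)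

end CountSketch

/-! ### From `ν` and the gap to `ε` -/

section Constants

variable {n d k : ℕ} {A : Matrix (Fin n) (Fin d) ℝ}

theorem specNorm_pos (hk : 1 ≤ k) (hr : k ≤ A.rank) : 0 < specNorm A := by
  rw [specNorm_eq_sigma_one]
  exact (sigma_pos_iff A le_rfl).mpr (hk.trans hr)

theorem one_le_stableRank (hA : 0 < specNorm A) : 1 ≤ stableRank A := by
  rw [stableRank, one_le_div (by positivity)]
  exact specNorm_sq_le_sum_sq A

/-- As `ν < 1/2`, `ν/(1+ν) ≥ 2ν/3`; the constant is `(3/2)²`. -/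
theorem gap_sq_mul_sq_le {ν : ℝ} (hν : 0 < ν) (hν' : ν < 1 / 2) :
    gap A k ^ 2 * ν ^ 2 ≤ 9 / 4 * (ν / (1 + ν) * gap A k) ^ 2 := by
  have h : 2 / 3 * ν ≤ ν / (1 + ν) := by
    rw [le_div_iff₀ (by positivity)]
    nlinarith
  have h2 := pow_le_pow_left₀ (by positivity) h 2
  rw [mul_pow _ (gap A k)]
  nlinarith [mul_le_mul_of_nonneg_right h2 (sq_nonneg (gap A k))]

theorem approxGram_countSketch {t : ℕ} (hk : 1 ≤ k) (hr : k ≤ A.rank)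
    (hgap : sigma A (k + 1) < sigma A k) {ν δ : ℝ} (hν : 0 < ν) (hν' : ν < 1 / 2) (hδ : 0 < δ)
    (ht : 9 / 2 * (stableRank A ^ 2 / (gap A k ^ 2 * ν ^ 2 * δ)) ≤ t) :
    ApproxGram (countSketch t d) Aᵀ (ν / (1 + ν) * gap A k) δ := by
  have hA := specNorm_pos hk hr
  have hg := gap_pos hk hr hgap
  have hs := one_le_stableRank hA
  have ht0 : (0 : ℝ) < t := lt_of_lt_of_le (by positivity) ht
  have : NeZero t := ⟨fun h => by simp [h] at ht0⟩
  refine approxGram_countSketch_of_le hA (by positivity) hδ (le_trans ?_ ht)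
  rw [← mul_div_assoc, div_le_div_iff₀ (by positivity) (by positivity)]
  have := mul_le_mul_of_nonneg_left (gap_sq_mul_sq_le (A := A) (k := k) hν hν')
    (by positivity : 0 ≤ 2 * stableRank A ^ 2 * δ)
  linarith

end Constants

end SketchedPCR

namespace SketchedPCR

/-! ### Squares of subgaussian variables are subexponential -/

section SquareMGF

variable {Ω : Type*} [MeasurableSpace Ω] {μ : Measure Ω} [IsProbabilityMeasure μ]
  {X : Ω → ℝ} {c : ℝ≥0}

/-- The exact value is `√2`. -/
theorem lintegral_exp_sq_gaussianReal :
    ∫⁻ s, ENNReal.ofReal (Real.exp (s ^ 2 / 4)) ∂(gaussianReal 0 1) ≤ ENNReal.ofReal (3 / 2) := by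
  rw [gaussianReal_of_var_ne_zero 0 one_ne_zero,
    lintegral_withDensity_eq_lintegral_mul _ (measurable_gaussianPDF 0 1) (by fun_prop)]
  have h1 : ∀ s, (gaussianPDF 0 1 * fun s => ENNReal.ofReal (Real.exp (s ^ 2 / 4))) s =
      ENNReal.ofReal ((√(2 * Real.pi))⁻¹ * Real.exp (-(1 / 4) * s ^ 2)) := by
    intro s
    rw [Pi.mul_apply, gaussianPDF, ← ENNReal.ofReal_mul (gaussianPDFReal_nonneg _ _ _),
      gaussianPDFReal_def]
    dsimp only
    rw [mul_assoc, ← Real.exp_add]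
    congr 2
    · simp
    · congr 1
      simp only [NNReal.coe_one]
      ring
  simp only [h1]
  rw [← ofReal_integral_eq_lintegral_ofReal]
  · refine ENNReal.ofReal_le_ofReal ?_
    rw [integral_const_mul, integral_gaussian, ← Real.sqrt_inv, ← Real.sqrt_mul (by positivity)]
    rw [Real.sqrt_le_left (by norm_num)]
    have := Real.pi_ne_zero
    field_simp
    norm_num
  · exact (integrable_exp_neg_mul_sq (by norm_num)).const_mul _
  · exact Filter.Eventually.of_forall fun s => by positivity

/-- The square of a subgaussian variable is exponentially integrable. -/
theorem integral_exp_sq_le (h : HasSubgaussianMGF X c μ) (hX : Measurable X) (hc : 0 < c) :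
    Integrable (fun ω => Real.exp (X ω ^ 2 / (4 * c))) μ ∧
      ∫ ω, Real.exp (X ω ^ 2 / (4 * c)) ∂μ ≤ 3 / 2 := by
  have hc' : (0 : ℝ) < c := hc
  set r : ℝ := √(2 * c) with hr
  have hr2 : r ^ 2 = 2 * c := Real.sq_sqrt (by positivity)
  have hr0 : 0 < r := Real.sqrt_pos.mpr (by positivity)
  have key : ∫⁻ ω, ENNReal.ofReal (Real.exp (X ω ^ 2 / (4 * c))) ∂μ ≤ ENNReal.ofReal (3 / 2) := by
    -- Gaussian linearization: `exp (x²/(4c))` is the mean of `exp (x s / √(2c))` over a standard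
    -- normal `s`. After exchanging integrals the subgaussian bound applies for fixed `s` and leaves
    -- `exp (s²/4)`.
    have h1 : ∀ x : ℝ, ENNReal.ofReal (Real.exp (x ^ 2 / (4 * c))) =
        ∫⁻ s, ENNReal.ofReal (Real.exp (x / r * s)) ∂(gaussianReal 0 1) := by
      intro x
      have hm := mgf_gaussianReal (p := gaussianReal 0 1) (X := id) Measure.map_id (x / r)
      rw [← ofReal_integral_eq_lintegral_ofReal]
      · rw [mgf] at hm
        simp only [id] at hm
        rw [hm]
        congr 2
        rw [div_pow, hr2]
        simp
        field_simp
        norm_num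
      · exact (integrable_exp_mul_gaussianReal (x / r))
      · exact Filter.Eventually.of_forall fun s => (Real.exp_pos _).le
    simp only [h1]
    rw [lintegral_lintegral_swap (by fun_prop)]
    refine le_trans (lintegral_mono fun s => ?_) lintegral_exp_sq_gaussianReal
    have h2 := h.mgf_le (s / r)
    have h3 : ∀ ω, X ω / r * s = s / r * X ω := fun ω => by ring
    simp only [h3]
    rw [← ofReal_integral_eq_lintegral_ofReal (h.integrable_exp_mul _)
      (Filter.Eventually.of_forall fun s => (Real.exp_pos _).le)]
    refine ENNReal.ofReal_le_ofReal (h2.trans_eq ?_)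
    rw [div_pow, hr2]
    congr 1
    field_simp
    norm_num
  have hint : Integrable (fun ω => Real.exp (X ω ^ 2 / (4 * c))) μ := by
    refine ⟨by fun_prop, ?_⟩
    rw [hasFiniteIntegral_iff_ofReal (Filter.Eventually.of_forall fun _ => (Real.exp_pos _).le)]
    exact key.trans_lt ENNReal.ofReal_lt_top
  refine ⟨hint, ?_⟩
  rw [integral_eq_lintegral_of_nonneg_ae
    (Filter.Eventually.of_forall fun _ => (Real.exp_pos _).le) hint.1]
  exact ENNReal.toReal_le_of_le_ofReal (by norm_num) key

theorem exp_le_one_add_add_sq_mul_exp (x : ℝ) :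
    Real.exp x ≤ 1 + x + x ^ 2 * Real.exp |x| := by
  have h := Complex.norm_exp_sub_sum_le_norm_mul_exp (x : ℂ) 2
  have h2 : Complex.exp x - ∑ m ∈ Finset.range 2, (x : ℂ) ^ m / (m.factorial : ℂ) =
      ((Real.exp x - (1 + x) : ℝ) : ℂ) := by
    simp [Finset.sum_range_succ]
  rw [h2, Complex.norm_real, Complex.norm_real, Real.norm_eq_abs, Real.norm_eq_abs, sq_abs] at h
  linarith [le_abs_self (Real.exp x - (1 + x))]

/-- The centered square of a subgaussian variable is subexponential. -/
theorem mgf_sq_sub_le (h : HasSubgaussianMGF X c μ) (hX : Measurable X) (hc : 0 < c)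
    {v : ℝ} (hv : ∫ ω, X ω ^ 2 ∂μ = v) {θ : ℝ} (hθ : |θ| ≤ 1 / (8 * c)) :
    Integrable (fun ω => Real.exp (θ * (X ω ^ 2 - v))) μ ∧
      ∫ ω, Real.exp (θ * (X ω ^ 2 - v)) ∂μ ≤ Real.exp (1536 * (c * θ) ^ 2) := by
  have hc' : (0 : ℝ) < c := hc
  obtain ⟨hI, hE⟩ := integral_exp_sq_le h hX hc
  have hle : ∀ ω, X ω ^ 2 ≤ 4 * c * Real.exp (X ω ^ 2 / (4 * c)) := by
    intro ω
    rw [← div_le_iff₀' (by positivity)]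
    linarith [Real.add_one_le_exp (X ω ^ 2 / (4 * c))]
  have hI2 : Integrable (fun ω => X ω ^ 2) μ :=
    (hI.const_mul (4 * c)).mono' (by fun_prop) (Filter.Eventually.of_forall fun ω => by
      rw [Real.norm_eq_abs, abs_of_nonneg (sq_nonneg _)]; exact hle ω)
  have hv0 : 0 ≤ v := hv ▸ integral_nonneg fun ω => sq_nonneg _
  have hv1 : v / (4 * c) ≤ 3 / 2 := by
    rw [div_le_iff₀' (by positivity), ← hv]
    calc ∫ ω, X ω ^ 2 ∂μ ≤ ∫ ω, 4 * c * Real.exp (X ω ^ 2 / (4 * c)) ∂μ :=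
          integral_mono hI2 (hI.const_mul _) hle
      _ ≤ _ := by rw [integral_const_mul]; gcongr
  have hexp : Real.exp (v / (4 * c)) ≤ 8 := by
    refine (Real.exp_le_exp.mpr (hv1.trans (by norm_num : (3 / 2 : ℝ) ≤ 2))).trans ?_
    have := Real.exp_one_lt_d9
    have h2 : Real.exp 2 = Real.exp 1 * Real.exp 1 := by rw [← Real.exp_add]; norm_num
    rw [h2]
    nlinarith [Real.exp_pos 1]
  have hpt : ∀ ω, Real.exp (θ * (X ω ^ 2 - v)) ≤
      1 + θ * (X ω ^ 2 - v) + 1024 * (c * θ) ^ 2 * Real.exp (X ω ^ 2 / (4 * c)) := by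
    intro ω
    refine (exp_le_one_add_add_sq_mul_exp _).trans (add_le_add le_rfl ?_)
    -- The scale `8c` makes `|θ (X² - v)| ≤ u` and `2u ≤ (X² + v)/(4c)`. The constant is `64 · 2 · 8
    -- = 1024`: from the scale, from `u² ≤ 2 exp u`, and from `exp (v/(4c)) ≤ 8`. The mean of `exp
    -- (X²/(4c))` then gives `1024 · 3/2 = 1536`.
    set u := |X ω ^ 2 - v| / (8 * c) with hu
    have hu0 : 0 ≤ u := by positivity
    have hcu : |X ω ^ 2 - v| = 8 * c * u := by rw [hu]; field_simp
    have h1 : |θ * (X ω ^ 2 - v)| ≤ u := by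
      rw [abs_mul, hu, div_eq_mul_one_div, mul_comm]
      gcongr
    have h2 : (θ * (X ω ^ 2 - v)) ^ 2 = 64 * (c * θ) ^ 2 * u ^ 2 := by
      rw [mul_pow, ← sq_abs (X ω ^ 2 - v), hcu]; ring
    have h3 : u ^ 2 ≤ 2 * Real.exp u := by
      linarith [Real.quadratic_le_exp_of_nonneg hu0]
    have h4 : Real.exp u * Real.exp u ≤ 8 * Real.exp (X ω ^ 2 / (4 * c)) := by
      have : |X ω ^ 2 - v| ≤ X ω ^ 2 + v :=
        abs_le.mpr ⟨by linarith [sq_nonneg (X ω)], by linarith⟩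
      have h5 : u + u ≤ X ω ^ 2 / (4 * c) + v / (4 * c) := by
        rw [hu, ← add_div, ← add_div, div_le_div_iff₀ (by positivity) (by positivity)]
        nlinarith
      rw [← Real.exp_add]
      refine (Real.exp_le_exp.mpr h5).trans ?_
      rw [Real.exp_add, mul_comm]
      gcongr
    rw [h2]
    calc 64 * (c * θ) ^ 2 * u ^ 2 * Real.exp |θ * (X ω ^ 2 - v)|
        ≤ 64 * (c * θ) ^ 2 * (2 * Real.exp u) * Real.exp u := by gcongr
      _ = 128 * (c * θ) ^ 2 * (Real.exp u * Real.exp u) := by ring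
      _ ≤ 128 * (c * θ) ^ 2 * (8 * Real.exp (X ω ^ 2 / (4 * c))) := by gcongr
      _ = _ := by ring
  have hI3 : Integrable (fun ω => θ * (X ω ^ 2 - v)) μ :=
    (hI2.sub (integrable_const v)).const_mul θ
  have hI4 : Integrable (fun ω => 1 + θ * (X ω ^ 2 - v)) μ := (integrable_const 1).add hI3
  have hI5 := hI.const_mul (1024 * (c * θ) ^ 2)
  have hint : Integrable (fun ω => Real.exp (θ * (X ω ^ 2 - v))) μ :=
    (hI4.add hI5).mono' (by fun_prop) (Filter.Eventually.of_forall fun ω => by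
      rw [Real.norm_eq_abs, abs_of_pos (Real.exp_pos _)]; exact hpt ω)
  refine ⟨hint, ?_⟩
  calc ∫ ω, Real.exp (θ * (X ω ^ 2 - v)) ∂μ
      ≤ ∫ ω, (1 + θ * (X ω ^ 2 - v) + 1024 * (c * θ) ^ 2 * Real.exp (X ω ^ 2 / (4 * c))) ∂μ :=
        integral_mono hint (hI4.add hI5) hpt
    _ = 1 + 1024 * (c * θ) ^ 2 * ∫ ω, Real.exp (X ω ^ 2 / (4 * c)) ∂μ := by
        rw [integral_add hI4 hI5, integral_add (integrable_const 1) hI3, integral_const_mul,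
          integral_const_mul, integral_sub hI2 (integrable_const v), hv]
        simp
    _ ≤ 1 + 1024 * (c * θ) ^ 2 * (3 / 2) := by gcongr
    _ = 1536 * (c * θ) ^ 2 + 1 := by ring
    _ ≤ _ := Real.add_one_le_exp _

/-- The difference between the moment generating function and `exp (c t²/2)` is at most `0`, with
equality at `0`. Its derivative there, which is the mean, vanishes. -/
theorem integral_eq_zero_of_hasSubgaussianMGF (h : HasSubgaussianMGF X c μ) : ∫ ω, X ω ∂μ = 0 := by
  have h0 : (0 : ℝ) ∈ interior (integrableExpSet X μ) := by
    simp [h.integrableExpSet_eq_univ]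
  have h1 := hasDerivAt_mgf h0
  have h2 : HasDerivAt (fun t : ℝ => Real.exp (c * t ^ 2 / 2)) 0 0 := by
    have : HasDerivAt (fun t : ℝ => (c : ℝ) * t ^ 2 / 2) 0 0 := by
      simpa using (((hasDerivAt_pow 2 (0 : ℝ)).const_mul (c : ℝ)).div_const 2)
    simpa using this.exp
  have h3 : IsLocalMax (fun t => mgf X μ t - Real.exp (c * t ^ 2 / 2)) 0 :=
    Filter.Eventually.of_forall fun t => by
      have := h.mgf_le t
      simp only [mgf_zero]
      simpa using this
  have h4 := h3.hasDerivAt_eq_zero (h1.sub h2)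
  simpa using h4

end SquareMGF

/-! ### One row of the sketch -/

section Rows

variable {d : ℕ} {ρ : Measure ℝ} [IsProbabilityMeasure ρ] {c : ℝ≥0}

/-- The parameters `y_j² c` of independent summands add up to `‖y‖² c ≤ c`. -/
theorem hasSubgaussianMGF_dotProduct (h : HasSubgaussianMGF id c ρ) {y : EuclideanSpace ℝ (Fin d)}
    (hy : ‖y‖ ≤ 1) :
    HasSubgaussianMGF (fun g : Fin d → ℝ => ∑ j, g j * y j) c (Measure.pi fun _ => ρ) := by
  have hj : ∀ j : Fin d, HasSubgaussianMGF (fun g : Fin d → ℝ => y j * g j)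
      (Real.toNNReal (y j ^ 2) * c) (Measure.pi fun _ => ρ) := by
    intro j
    have h1 : HasSubgaussianMGF (fun g : Fin d → ℝ => g j) c (Measure.pi fun _ => ρ) := by
      rw [← HasSubgaussianMGF.id_map_iff (measurable_pi_apply j).aemeasurable]
      have := (measurePreserving_eval (fun _ : Fin d => ρ) j).map_eq
      rw [show (Measure.pi fun _ : Fin d => ρ).map (fun g => g j) = ρ from this]
      exact h
    rw [Real.toNNReal_of_nonneg (sq_nonneg _)]
    exact h1.const_mul (y j)
  have hind : iIndepFun (fun (j : Fin d) (g : Fin d → ℝ) => y j * g j)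
      (Measure.pi fun _ => ρ) :=
    iIndepFun_pi (X := fun j x => y j * x) fun j => by fun_prop
  have hs := HasSubgaussianMGF.sum_of_iIndepFun hind (s := Finset.univ) fun j _ => hj j
  simp only [mul_comm (y _)] at hs
  refine ⟨hs.integrable_exp_mul, fun s => (hs.mgf_le s).trans (Real.exp_le_exp.mpr ?_)⟩
  rw [← Finset.sum_mul]
  have hsum : ((∑ j, Real.toNNReal (y j ^ 2) : ℝ≥0) : ℝ) ≤ 1 := by
    rw [NNReal.coe_sum]
    have := EuclideanSpace.norm_sq_eq y
    simp only [Real.norm_eq_abs, sq_abs] at this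
    simp only [Real.coe_toNNReal _ (sq_nonneg _)]
    rw [← this]
    exact pow_le_one₀ (norm_nonneg _) hy
  rw [NNReal.coe_mul]
  have : (0 : ℝ) ≤ c := c.2
  gcongr
  exact mul_le_of_le_one_left this hsum

theorem integral_sq_dotProduct (h : HasSubgaussianMGF id c ρ) {y : EuclideanSpace ℝ (Fin d)}
    (hy : ‖y‖ ≤ 1) :
    ∫ g : Fin d → ℝ, (∑ j, g j * y j) ^ 2 ∂(Measure.pi fun _ => ρ) = Var[id; ρ] * ‖y‖ ^ 2 := by
  have hs := hasSubgaussianMGF_dotProduct h hy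
  have hm : MemLp (id : ℝ → ℝ) 2 ρ := h.memLp 2
  have h1 := variance_sum_pi (μ := fun _ : Fin d => ρ) (X := fun j x => y j * x)
    fun j => hm.const_mul (y j)
  have h2 : (∑ j, fun g : Fin d → ℝ => y j * g j) = fun g => ∑ j, g j * y j := by
    ext g; simp [mul_comm]
  rw [h2, variance_of_integral_eq_zero hs.aemeasurable
    (integral_eq_zero_of_hasSubgaussianMGF hs)] at h1
  rw [h1, EuclideanSpace.norm_sq_eq, Finset.mul_sum]
  refine Finset.sum_congr rfl fun j _ => ?_
  have := variance_const_mul (y j) (id : ℝ → ℝ) ρ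
  simp only [id] at this
  rw [this, Real.norm_eq_abs, sq_abs, mul_comm]

end Rows

end SketchedPCR

namespace SketchedPCR

/-! ### Exponential moments of the sketched inner products -/

section IidSketch

variable {t d : ℕ} {ρ : Measure ℝ} [IsProbabilityMeasure ρ] {c : ℝ≥0}

/-- The matrix of given entries, divided by `√(t v)`. -/
noncomputable def scaledMatrix (v : ℝ) (ω : Fin t → Fin d → ℝ) : Matrix (Fin t) (Fin d) ℝ :=
  Matrix.of fun i j => ω i j / √(t * v)

/-- The error of the sketched inner product of `y` and `z`. -/
noncomputable def gramError (S : Matrix (Fin t) (Fin d) ℝ) (y z : EuclideanSpace ℝ (Fin d)) : ℝ :=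
  inner ℝ (Matrix.toEuclideanLin S y) (Matrix.toEuclideanLin S z) - inner ℝ y z

/-- Polarization, with halves so that the arguments stay in the unit ball. -/
theorem gramError_eq_sub (S : Matrix (Fin t) (Fin d) ℝ) (y z : EuclideanSpace ℝ (Fin d)) :
    gramError S y z =
      gramError S ((1 / 2 : ℝ) • (y + z)) ((1 / 2 : ℝ) • (y + z)) -
        gramError S ((1 / 2 : ℝ) • (y - z)) ((1 / 2 : ℝ) • (y - z)) := by
  simp only [gramError, map_smul, map_add, map_sub, inner_smul_left, inner_smul_right,
    inner_add_left, inner_add_right, inner_sub_left, inner_sub_right]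
  rw [real_inner_comm (Matrix.toEuclideanLin S y) (Matrix.toEuclideanLin S z),
    real_inner_comm y z]
  simp
  ring

theorem gramError_self_eq (ht : 0 < t) {v : ℝ} (hv : 0 < v) (ω : Fin t → Fin d → ℝ)
    (y : EuclideanSpace ℝ (Fin d)) :
    gramError (scaledMatrix v ω) y y =
      ∑ i, (t * v)⁻¹ * ((∑ j, ω i j * y j) ^ 2 - v * ‖y‖ ^ 2) := by
  have ht' : (0 : ℝ) < t := by exact_mod_cast ht
  rw [gramError, real_inner_self_eq_norm_sq, real_inner_self_eq_norm_sq, EuclideanSpace.norm_sq_eq,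
    ← Finset.mul_sum, Finset.sum_sub_distrib, Finset.sum_const, Finset.card_univ,
    Fintype.card_fin, nsmul_eq_mul, mul_sub, ← mul_assoc, ← mul_assoc,
    mul_assoc _ (t : ℝ) v, inv_mul_cancel₀ (by positivity), one_mul, Finset.mul_sum]
  congr 1
  refine Finset.sum_congr rfl fun i _ => ?_
  simp only [Real.norm_eq_abs, sq_abs, Matrix.toLpLin_apply, Matrix.mulVec, dotProduct,
    scaledMatrix, Matrix.of_apply]
  have : ∀ j, ω i j / √(t * v) * y j = (√(t * v))⁻¹ * (ω i j * y j) := fun j => by ring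
  simp only [this]
  rw [← Finset.mul_sum, mul_pow, inv_pow, Real.sq_sqrt (by positivity)]

theorem pos_of_hasSubgaussianMGF (h : HasSubgaussianMGF id c ρ) (hv : 0 < Var[id; ρ]) :
    0 < c := by
  by_contra hc
  have hc0 : c = 0 := le_antisymm (not_lt.mp hc) zero_le
  rw [hc0] at h
  have := h.ae_eq_zero_of_hasSubgaussianMGF_zero
  rw [variance_congr this] at hv
  simp at hv

/-- The error is a sum over `t` independent rows of centered squares, so the integral is the `t`-th
power of a one-row bound at `θ = l/(t v)`. The condition on `l` is `|θ| ≤ 1/(8Kv)`, which implies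
the one-row range because `c ≤ K v`. -/
theorem integral_exp_gramError_self_le (h : HasSubgaussianMGF id c ρ)
    (hv : 0 < Var[id; ρ]) {K : ℝ} (hK : 0 < K) (hcK : (c : ℝ) ≤ K * Var[id; ρ]) (ht : 0 < t)
    {y : EuclideanSpace ℝ (Fin d)} (hy : ‖y‖ ≤ 1) {l : ℝ}
    (hl : |l| ≤ t / (8 * K)) :
    Integrable (fun ω : Fin t → Fin d → ℝ =>
        Real.exp (l * gramError (scaledMatrix Var[id; ρ] ω) y y))
      (Measure.pi fun _ => Measure.pi fun _ => ρ) ∧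
    ∫ ω : Fin t → Fin d → ℝ, Real.exp (l * gramError (scaledMatrix Var[id; ρ] ω) y y)
        ∂(Measure.pi fun _ => Measure.pi fun _ => ρ) ≤ Real.exp (1536 * K ^ 2 * l ^ 2 / t) := by
  set v := Var[id; ρ] with hvd
  have ht' : (0 : ℝ) < t := by exact_mod_cast ht
  have hc : (0 : ℝ) < c := pos_of_hasSubgaussianMGF h hv
  set θ := l * (t * v)⁻¹ with hθ
  have hrow := mgf_sq_sub_le (hasSubgaussianMGF_dotProduct h hy) (by fun_prop)
    (pos_of_hasSubgaussianMGF h hv) (integral_sq_dotProduct h hy) (θ := θ) (by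
      rw [hθ, abs_mul, abs_of_pos (by positivity : 0 < (t * v)⁻¹)]
      calc |l| * (t * v)⁻¹ ≤ t / (8 * K) * (t * v)⁻¹ := by gcongr
        _ = 1 / (8 * (K * v)) := by field_simp
        _ ≤ 1 / (8 * c) := by gcongr)
  have heq : ∀ ω : Fin t → Fin d → ℝ, Real.exp (l * gramError (scaledMatrix v ω) y y) =
      ∏ i, Real.exp (θ * ((∑ j, ω i j * y j) ^ 2 - v * ‖y‖ ^ 2)) := by
    intro ω
    rw [← Real.exp_sum, gramError_self_eq ht hv, Finset.mul_sum]
    congr 1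
    exact Finset.sum_congr rfl fun i _ => by rw [hθ]; ring
  simp only [heq]
  refine ⟨Integrable.fintype_prod (f := fun _ (g : Fin d → ℝ) =>
    Real.exp (θ * ((∑ j, g j * y j) ^ 2 - v * ‖y‖ ^ 2))) fun _ => hrow.1, ?_⟩
  rw [integral_fintype_prod_eq_prod (f := fun _ (g : Fin d → ℝ) =>
    Real.exp (θ * ((∑ j, g j * y j) ^ 2 - v * ‖y‖ ^ 2))), Finset.prod_const, Finset.card_univ,
    Fintype.card_fin]
  refine (pow_le_pow_left₀ (integral_nonneg fun _ => (Real.exp_pos _).le) hrow.2 t).trans ?_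
  rw [← Real.exp_nat_mul]
  refine Real.exp_le_exp.mpr ?_
  have h1 : (c * θ) ^ 2 ≤ (K * v * θ) ^ 2 := by
    rw [mul_pow, mul_pow (K * v)]
    gcongr
  calc (t : ℝ) * (1536 * (c * θ) ^ 2) ≤ t * (1536 * (K * v * θ) ^ 2) := by gcongr
    _ = _ := by rw [hθ]; field_simp

/-- After polarization, `exp (x + w) ≤ (exp (2x) + exp (2w))/2` separates the two dependent errors.
Doubling `l` halves the admissible range and multiplies the exponent constant by four. -/
theorem integral_cosh_gramError_le (h : HasSubgaussianMGF id c ρ)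
    (hv : 0 < Var[id; ρ]) {K : ℝ} (hK : 0 < K) (hcK : (c : ℝ) ≤ K * Var[id; ρ]) (ht : 0 < t)
    {y z : EuclideanSpace ℝ (Fin d)} (hy : ‖y‖ ≤ 1)
    (hz : ‖z‖ ≤ 1) {l : ℝ} (hl : |l| ≤ t / (16 * K)) :
    Integrable (fun ω : Fin t → Fin d → ℝ =>
        Real.cosh (l * gramError (scaledMatrix Var[id; ρ] ω) y z))
      (Measure.pi fun _ => Measure.pi fun _ => ρ) ∧
    ∫ ω : Fin t → Fin d → ℝ, Real.cosh (l * gramError (scaledMatrix Var[id; ρ] ω) y z)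
        ∂(Measure.pi fun _ => Measure.pi fun _ => ρ) ≤ Real.exp (6144 * K ^ 2 * l ^ 2 / t) := by
  set a : EuclideanSpace ℝ (Fin d) := (1 / 2 : ℝ) • (y + z) with ha
  set b : EuclideanSpace ℝ (Fin d) := (1 / 2 : ℝ) • (y - z) with hb
  have han : ‖a‖ ≤ 1 := by
    rw [ha, norm_smul, Real.norm_of_nonneg (by norm_num)]
    linarith [norm_add_le y z]
  have hbn : ‖b‖ ≤ 1 := by
    rw [hb, norm_smul, Real.norm_of_nonneg (by norm_num)]
    linarith [norm_sub_le y z]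
  have hl2 : |2 * l| ≤ t / (8 * K) := by
    rw [abs_mul, abs_two]
    calc 2 * |l| ≤ 2 * (t / (16 * K)) := by gcongr
      _ = _ := by field_simp; norm_num
  have hl3 : |-(2 * l)| ≤ t / (8 * K) := by rwa [abs_neg]
  have e1 := integral_exp_gramError_self_le h hv hK hcK ht han hl2
  have e2 := integral_exp_gramError_self_le h hv hK hcK ht han hl3
  have e3 := integral_exp_gramError_self_le h hv hK hcK ht hbn hl2
  have e4 := integral_exp_gramError_self_le h hv hK hcK ht hbn hl3
  set F : (Fin t → Fin d → ℝ) → ℝ := fun ω => (1 / 4 : ℝ) *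
    ((Real.exp (2 * l * gramError (scaledMatrix Var[id; ρ] ω) a a) +
      Real.exp (-(2 * l) * gramError (scaledMatrix Var[id; ρ] ω) a a)) +
     (Real.exp (2 * l * gramError (scaledMatrix Var[id; ρ] ω) b b) +
      Real.exp (-(2 * l) * gramError (scaledMatrix Var[id; ρ] ω) b b))) with hF
  have hFi : Integrable F (Measure.pi fun _ => Measure.pi fun _ => ρ) :=
    ((e1.1.add e2.1).add (e3.1.add e4.1)).const_mul _
  have hpt : ∀ ω, Real.cosh (l * gramError (scaledMatrix Var[id; ρ] ω) y z) ≤ F ω := by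
    intro ω
    rw [gramError_eq_sub, ← ha, ← hb, Real.cosh_eq, hF]
    dsimp only
    set A := gramError (scaledMatrix Var[id; ρ] ω) a a
    set B := gramError (scaledMatrix Var[id; ρ] ω) b b
    have amgm : ∀ x w : ℝ, Real.exp (x + w) ≤ (Real.exp (2 * x) + Real.exp (2 * w)) / 2 := by
      intro x w
      rw [Real.exp_add, two_mul, two_mul, Real.exp_add, Real.exp_add]
      nlinarith [sq_nonneg (Real.exp x - Real.exp w)]
    have h1 := amgm (l * A) (-(l * B))
    have h2 := amgm (-(l * A)) (l * B)
    rw [show l * (A - B) = l * A + -(l * B) by ring,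
      show -(l * A + -(l * B)) = -(l * A) + l * B by ring,
      show 2 * l * A = 2 * (l * A) by ring, show -(2 * l) * A = 2 * (-(l * A)) by ring,
      show 2 * l * B = 2 * (l * B) by ring, show -(2 * l) * B = 2 * (-(l * B)) by ring]
    linarith
  have hmeas : AEStronglyMeasurable (fun ω : Fin t → Fin d → ℝ =>
      Real.cosh (l * gramError (scaledMatrix Var[id; ρ] ω) y z))
      (Measure.pi fun _ => Measure.pi fun _ => ρ) := by
    have : Continuous fun ω : Fin t → Fin d → ℝ =>
        Real.cosh (l * gramError (scaledMatrix Var[id; ρ] ω) y z) := by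
      simp only [gramError, scaledMatrix, Matrix.toLpLin_apply, PiLp.inner_apply, Matrix.mulVec,
        dotProduct, Matrix.of_apply, RCLike.inner_apply, conj_trivial]
      fun_prop
    exact this.aestronglyMeasurable
  have hint := hFi.mono' hmeas (Filter.Eventually.of_forall fun ω => by
    rw [Real.norm_eq_abs, abs_of_pos (Real.cosh_pos _)]; exact hpt ω)
  refine ⟨hint, (integral_mono hint hFi hpt).trans ?_⟩
  have hexp : 1536 * K ^ 2 * (2 * l) ^ 2 / t = 6144 * K ^ 2 * l ^ 2 / t := by ring
  have hexp' : 1536 * K ^ 2 * (-(2 * l)) ^ 2 / t = 6144 * K ^ 2 * l ^ 2 / t := by ring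
  rw [hexp] at e1 e3
  rw [hexp'] at e2 e4
  have i1 := e1.2; have i2 := e2.2; have i3 := e3.2; have i4 := e4.2
  rw [hF, integral_const_mul, integral_add (e1.1.fun_add e2.1) (e3.1.fun_add e4.1),
    integral_add e1.1 e2.1, integral_add e3.1 e4.1]
  linarith

end IidSketch

end SketchedPCR

namespace SketchedPCR

/-! ### Nets of unit balls -/

section Nets

variable {V : Type*} [NormedAddCommGroup V] [InnerProductSpace ℝ V] [FiniteDimensional ℝ V]

/-- The closed unit ball has a `1/2`-net with at most `5 ^ dim` points. -/
theorem exists_half_net : ∃ N : Finset V, N.card ≤ 5 ^ Module.finrank ℝ V ∧ (∀ y ∈ N, ‖y‖ ≤ 1) ∧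
    ∀ x : V, ‖x‖ ≤ 1 → ∃ y ∈ N, ‖x - y‖ ≤ 1 / 2 := by
  classical
  -- At scale two: a maximal `1`-separated set in the ball of radius `2` has at most `5 ^ dim`
  -- points, and halving it gives the net.
  let P : Finset V → Prop := fun s => (∀ c ∈ s, ‖c‖ ≤ 2) ∧ ∀ c ∈ s, ∀ d ∈ s, c ≠ d → 1 ≤ ‖c - d‖
  have hb : ∀ k, (∃ s, P s ∧ s.card = k) → k ≤ 5 ^ Module.finrank ℝ V := by
    rintro _ ⟨s, hs, rfl⟩
    exact Besicovitch.card_le_of_separated s hs.1 hs.2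
  obtain ⟨s, hs, hmax⟩ : ∃ s, P s ∧ ∀ s', P s' → s'.card ≤ s.card := by
    have h0 : ∃ k, ∃ s, P s ∧ s.card = k := ⟨0, ∅, by simp [P], rfl⟩
    obtain ⟨s, hs, hk⟩ := Nat.findGreatest_spec (P := fun k => ∃ s, P s ∧ s.card = k)
      (hb _ h0.choose_spec) h0.choose_spec
    exact ⟨s, hs, fun s' hs' => hk ▸ Nat.le_findGreatest (hb _ ⟨s', hs', rfl⟩) ⟨s', hs', rfl⟩⟩
  refine ⟨s.image fun c => (1 / 2 : ℝ) • c, Finset.card_image_le.trans (hb _ ⟨s, hs, rfl⟩), ?_, ?_⟩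
  · intro y hy
    obtain ⟨c, hc, rfl⟩ := Finset.mem_image.mp hy
    rw [norm_smul, Real.norm_of_nonneg (by norm_num)]
    linarith [hs.1 c hc]
  · intro x hx
    by_contra! hne
    have hfar : ∀ c ∈ s, 1 ≤ ‖(2 : ℝ) • x - c‖ := by
      intro c hc
      have h1 := hne _ (Finset.mem_image_of_mem _ hc)
      have h2 : x - (1 / 2 : ℝ) • c = (1 / 2 : ℝ) • ((2 : ℝ) • x - c) := by
        rw [smul_sub, smul_smul]; norm_num
      rw [h2, norm_smul, Real.norm_of_nonneg (by norm_num)] at h1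
      linarith
    have hnot : (2 : ℝ) • x ∉ s := fun hmem => by
      have := hfar _ hmem
      rw [sub_self, norm_zero] at this
      linarith
    have hP : P (insert ((2 : ℝ) • x) s) := by
      refine ⟨fun c hc => ?_, fun c hc d hd hcd => ?_⟩
      · rcases Finset.mem_insert.mp hc with rfl | hc
        · rw [norm_smul, Real.norm_of_nonneg (by norm_num)]; linarith
        · exact hs.1 c hc
      · rcases Finset.mem_insert.mp hc with rfl | hc <;>
          rcases Finset.mem_insert.mp hd with rfl | hd
        · exact absurd rfl hcd
        · exact hfar d hd
        · rw [norm_sub_rev]; exact hfar c hc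
        · exact hs.2 c hc d hd hcd
    have := hmax _ hP
    rw [Finset.card_insert_of_notMem hnot] at this
    omega

/-- A `1/2`-net of the unit ball of a subspace. -/
theorem exists_half_net_submodule (F : Submodule ℝ V) {m : ℕ} (hF : Module.finrank ℝ F ≤ m) :
    ∃ N : Finset V, N.card ≤ 5 ^ m ∧ (∀ y ∈ N, y ∈ F ∧ ‖y‖ ≤ 1) ∧
    ∀ x ∈ F, ‖x‖ ≤ 1 → ∃ y ∈ N, ‖x - y‖ ≤ 1 / 2 := by
  classical
  obtain ⟨N, hN, h1, h2⟩ := exists_half_net (V := F)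
  refine ⟨N.image Subtype.val, Finset.card_image_le.trans
    (hN.trans (Nat.pow_le_pow_right (by norm_num) hF)), ?_, ?_⟩
  · intro y hy
    obtain ⟨c, hc, rfl⟩ := Finset.mem_image.mp hy
    exact ⟨c.2, h1 c hc⟩
  · intro x hx hx1
    obtain ⟨y, hy, hxy⟩ := h2 ⟨x, hx⟩ hx1
    exact ⟨y, Finset.mem_image_of_mem _ hy, hxy⟩

/-- An operator is controlled by its bilinear form on `1/2`-nets. -/
theorem opNorm_le_of_nets {F G : Type*} [NormedAddCommGroup F] [InnerProductSpace ℝ F]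
    [NormedAddCommGroup G] [InnerProductSpace ℝ G] (T : F →L[ℝ] G) {N : Set F} {M : Set G}
    (hN : ∀ x : F, ‖x‖ ≤ 1 → ∃ y ∈ N, ‖x - y‖ ≤ 1 / 2)
    (hM : ∀ x : G, ‖x‖ ≤ 1 → ∃ y ∈ M, ‖x - y‖ ≤ 1 / 2) {Z : ℝ} (hZ : 0 ≤ Z)
    (h : ∀ y ∈ N, ∀ z ∈ M, inner ℝ (T y) z ≤ Z) : ‖T‖ ≤ 4 * Z := by
  have h1 : ∀ y ∈ N, ‖T y‖ ≤ 2 * Z := by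
    intro y hy
    rcases (norm_nonneg (T y)).eq_or_lt with h0 | h0
    · rw [← h0]; positivity
    obtain ⟨z, hz, hwz⟩ := hM (‖T y‖⁻¹ • T y) (by
      rw [norm_smul, norm_inv, norm_norm, inv_mul_cancel₀ h0.ne'])
    have e1 : inner ℝ (T y) (‖T y‖⁻¹ • T y) = ‖T y‖ := by
      rw [inner_smul_right, real_inner_self_eq_norm_mul_norm]
      field_simp
    have e2 : inner ℝ (T y) (‖T y‖⁻¹ • T y - z) ≤ ‖T y‖ * (1 / 2) :=
      (real_inner_le_norm _ _).trans (mul_le_mul_of_nonneg_left hwz h0.le)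
    rw [inner_sub_right, e1] at e2
    linarith [h y hy z hz]
  -- Each of the two nets costs a factor `2`: once for the dual vector in `h1`, once for the
  -- argument here.
  have h2 : ‖T‖ ≤ 2 * Z + ‖T‖ * (1 / 2) := by
    refine ContinuousLinearMap.opNorm_le_of_unit_norm (by positivity) fun x hx => ?_
    obtain ⟨y, hy, hxy⟩ := hN x hx.le
    calc ‖T x‖ = ‖T y + T (x - y)‖ := by rw [map_sub]; congr 1; abel
      _ ≤ ‖T y‖ + ‖T‖ * ‖x - y‖ := (norm_add_le _ _).trans (add_le_add le_rfl (T.le_opNorm _))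
      _ ≤ _ := add_le_add (h1 y hy) (mul_le_mul_of_nonneg_left hxy (norm_nonneg _))
  linarith

/-- `T` is compressed to an operator from `F` to `G`, so that nets of these subspaces suffice. -/
theorem inner_le_of_nets (T : V →L[ℝ] V) {F G : Submodule ℝ V} {N M : Finset V}
    (hN : ∀ y ∈ N, y ∈ F ∧ ‖y‖ ≤ 1) (hN' : ∀ x ∈ F, ‖x‖ ≤ 1 → ∃ y ∈ N, ‖x - y‖ ≤ 1 / 2)
    (hM : ∀ y ∈ M, y ∈ G ∧ ‖y‖ ≤ 1) (hM' : ∀ x ∈ G, ‖x‖ ≤ 1 → ∃ y ∈ M, ‖x - y‖ ≤ 1 / 2)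
    {Z : ℝ} (hZ : 0 ≤ Z) (h : ∀ y ∈ N, ∀ z ∈ M, inner ℝ (T y) z ≤ Z) {y z : V} (hy : y ∈ F)
    (hz : z ∈ G) : inner ℝ (T y) z ≤ 4 * Z * (‖y‖ * ‖z‖) := by
  let T' : F →L[ℝ] G := G.orthogonalProjectionOnto ∘L T ∘L F.subtypeL
  have hT' : ∀ (a : F) (b : G), inner ℝ (T' a) b = inner ℝ (T a) (b : V) := fun a b =>
    Submodule.inner_orthogonalProjectionOnto_eq_of_mem_right b (T a)
  have hn : ‖T'‖ ≤ 4 * Z := by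
    refine opNorm_le_of_nets T' (N := {y | (y : V) ∈ N}) (M := {y | (y : V) ∈ M}) ?_ ?_ hZ ?_
    · intro x hx
      obtain ⟨y, hy, hxy⟩ := hN' x x.2 hx
      exact ⟨⟨y, (hN y hy).1⟩, hy, hxy⟩
    · intro x hx
      obtain ⟨y, hy, hxy⟩ := hM' x x.2 hx
      exact ⟨⟨y, (hM y hy).1⟩, hy, hxy⟩
    · intro a ha b hb
      rw [hT']
      exact h _ ha _ hb
  have := hT' ⟨y, hy⟩ ⟨z, hz⟩
  rw [← this]
  refine (real_inner_le_norm _ _).trans ?_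
  calc ‖T' ⟨y, hy⟩‖ * ‖(⟨z, hz⟩ : G)‖ ≤ (‖T'‖ * ‖y‖) * ‖z‖ :=
        mul_le_mul_of_nonneg_right (T'.le_opNorm _) (norm_nonneg _)
    _ ≤ (4 * Z * ‖y‖) * ‖z‖ := by gcongr
    _ = _ := by ring

end Nets

/-! ### Convexity of `cosh (l √x)` -/

section Jensen

/-- Jensen's inequality for the convex function `x ↦ cosh (l √x)`. -/
theorem cosh_sqrt_sum_le {ι : Type*} [Fintype ι] {p : ι → ℝ} (hp : ∀ i, 0 ≤ p i)
    (hp1 : ∑ i, p i = 1) (l : ℝ) (z : ι → ℝ) :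
    Real.cosh (l * √(∑ i, p i * z i ^ 2)) ≤ ∑ i, p i * Real.cosh (l * z i) := by
  have h0 : 0 ≤ ∑ i, p i * z i ^ 2 :=
    Finset.sum_nonneg fun i _ => mul_nonneg (hp i) (sq_nonneg _)
  -- Termwise in the power series: only even powers of the square root occur, so each term is a
  -- convex power of the mean of the `z i ^ 2`.
  refine hasSum_le (fun n => ?_) (Real.hasSum_cosh _)
    (hasSum_sum fun i (_ : i ∈ Finset.univ) => (Real.hasSum_cosh (l * z i)).mul_left (p i))
  have hj := Real.pow_arith_mean_le_arith_mean_pow Finset.univ p (fun i => z i ^ 2)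
    (fun i _ => hp i) hp1 (fun i _ => sq_nonneg _) n
  rw [mul_pow, pow_mul (√_) 2 n, Real.sq_sqrt h0]
  calc l ^ (2 * n) * (∑ i, p i * z i ^ 2) ^ n / ((2 * n).factorial : ℝ)
      ≤ l ^ (2 * n) * (∑ i, p i * (z i ^ 2) ^ n) / ((2 * n).factorial : ℝ) := by
        have : 0 ≤ l ^ (2 * n) := by rw [pow_mul]; positivity
        gcongr
    _ = _ := by
        rw [Finset.mul_sum, Finset.sum_div]
        refine Finset.sum_congr rfl fun i _ => ?_
        rw [mul_pow, pow_mul (z i)]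
        ring

end Jensen

end SketchedPCR

namespace SketchedPCR

/-! ### Blocks of singular directions -/

section Blocks

variable {m n : Type*} [Fintype m] [DecidableEq m] [Fintype n] [DecidableEq n]
  {A : Matrix m n ℝ}

/-- The index of the block of `q` consecutive indices that contains `p`. -/
def blockIndex {r : ℕ} (q : ℕ) (p : Fin r) : Fin r :=
  ⟨p.val / q, (Nat.div_le_self _ _).trans_lt p.2⟩

namespace ThinSVD

variable (s : ThinSVD A)

/-- The span of a block of right singular vectors. -/
def blockSpan (q : ℕ) (I : Fin (min (Fintype.card m) (Fintype.card n))) :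
    Submodule ℝ (EuclideanSpace ℝ n) :=
  Submodule.span ℝ (Set.range fun p : {p // blockIndex q p = I} => s.v p)

theorem finrank_blockSpan_le {q : ℕ} (hq : 0 < q) (I) :
    Module.finrank ℝ (s.blockSpan q I) ≤ q := by
  refine (finrank_range_le_card _).trans ?_
  refine (Fintype.card_le_of_injective
    (fun p : {p // blockIndex q p = I} => (⟨p.val.val % q, Nat.mod_lt _ hq⟩ : Fin q)) ?_).trans_eq
    (Fintype.card_fin q)
  rintro ⟨p, hp⟩ ⟨p', hp'⟩ h
  have h1 : p.val / q = p'.val / q := congrArg Fin.val (hp.trans hp'.symm)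
  have h2 : p.val % q = p'.val % q := congrArg Fin.val h
  refine Subtype.ext (Fin.ext ?_)
  rw [← Nat.div_add_mod p.val q, ← Nat.div_add_mod p'.val q, h1, h2]

/-- The component of `Aᵀ x` in a block of right singular vectors. -/
noncomputable def blockPart (q : ℕ) (I : Fin (min (Fintype.card m) (Fintype.card n)))
    (x : EuclideanSpace ℝ m) : EuclideanSpace ℝ n :=
  ∑ p, (if blockIndex q p = I then sigma A (p.val + 1) * inner ℝ (s.u p) x else 0) • s.v p

/-- The norm of the coordinates of `x` in a block of left singular vectors. -/
noncomputable def blockNorm (q : ℕ) (I : Fin (min (Fintype.card m) (Fintype.card n)))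
    (x : EuclideanSpace ℝ m) : ℝ :=
  √(∑ p, if blockIndex q p = I then inner ℝ (s.u p) x ^ 2 else 0)

theorem blockNorm_sq (q : ℕ) (I) (x : EuclideanSpace ℝ m) : s.blockNorm q I x ^ 2 =
    ∑ p, if blockIndex q p = I then inner ℝ (s.u p) x ^ 2 else 0 :=
  Real.sq_sqrt (Finset.sum_nonneg fun p _ => by split_ifs <;> positivity)

theorem blockPart_mem (q : ℕ) (I) (x : EuclideanSpace ℝ m) :
    s.blockPart q I x ∈ s.blockSpan q I := by
  refine Submodule.sum_mem _ fun p _ => ?_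
  split_ifs with h
  · exact Submodule.smul_mem _ _ (Submodule.subset_span ⟨⟨p, h⟩, rfl⟩)
  · simp

theorem sum_blockPart (q : ℕ) (x : EuclideanSpace ℝ m) :
    ∑ I, s.blockPart q I x = Matrix.toEuclideanLin Aᵀ x := by
  simp only [blockPart]
  rw [Finset.sum_comm, s.transpose_apply_eq]
  refine Finset.sum_congr rfl fun p _ => ?_
  rw [← Finset.sum_smul]
  simp

theorem sum_blockNorm_sq_le (q : ℕ) (x : EuclideanSpace ℝ m) :
    ∑ I, s.blockNorm q I x ^ 2 ≤ ‖x‖ ^ 2 := by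
  refine le_trans (le_of_eq ?_) (sum_inner_sq_le s.orthonormal_u x)
  simp only [blockNorm_sq]
  rw [Finset.sum_comm]
  simp

theorem norm_blockPart_le (q : ℕ) (I) (x : EuclideanSpace ℝ m) :
    ‖s.blockPart q I x‖ ≤ sigma A (I.val * q + 1) * s.blockNorm q I x := by
  have h0 := sigma_nonneg A (I.val * q + 1)
  have hn : 0 ≤ s.blockNorm q I x := Real.sqrt_nonneg _
  refine abs_le_of_sq_le_sq' ?_ (mul_nonneg h0 hn) |>.2
  rw [blockPart, norm_sq_sum_smul s.orthonormal_v, mul_pow, blockNorm_sq,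
    Finset.mul_sum]
  refine Finset.sum_le_sum fun p _ => ?_
  split_ifs with h
  · rw [mul_pow]
    have h1 : sigma A (p.val + 1) ≤ sigma A (I.val * q + 1) :=
      sigma_anti A (Nat.succ_le_succ (h ▸ Nat.div_mul_le_self _ _))
    have h2 := sigma_nonneg A (p.val + 1)
    gcongr
  · simp

/-- A block decomposition bounds the compression of an operator by `A`. -/
theorem inner_apply_transpose_le_of_blocks (q : ℕ)
    (T : EuclideanSpace ℝ n →L[ℝ] EuclideanSpace ℝ n)
    {Z : Fin (min (Fintype.card m) (Fintype.card n)) →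
      Fin (min (Fintype.card m) (Fintype.card n)) → ℝ} (hZ : ∀ I J, 0 ≤ Z I J)
    (h : ∀ I J, ∀ y ∈ s.blockSpan q I, ∀ z ∈ s.blockSpan q J,
      inner ℝ (T y) z ≤ 4 * Z I J * (‖y‖ * ‖z‖)) (a b : EuclideanSpace ℝ m) :
    inner ℝ (T (Matrix.toEuclideanLin Aᵀ a)) (Matrix.toEuclideanLin Aᵀ b) ≤
      4 * √(∑ P : _ × _, (sigma A (P.1.val * q + 1) ^ 2 * sigma A (P.2.val * q + 1) ^ 2) *
        Z P.1 P.2 ^ 2) * (‖a‖ * ‖b‖) := by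
  rw [← s.sum_blockPart q a, ← s.sum_blockPart q b, map_sum, sum_inner]
  simp only [inner_sum]
  rw [← Fintype.sum_prod_type' (f := fun I J =>
    inner ℝ (T (s.blockPart q I a)) (s.blockPart q J b))]
  calc ∑ P : _ × _, inner ℝ (T (s.blockPart q P.1 a)) (s.blockPart q P.2 b)
      ≤ ∑ P : _ × _, 4 * ((sigma A (P.1.val * q + 1) * sigma A (P.2.val * q + 1) * Z P.1 P.2) *
          (s.blockNorm q P.1 a * s.blockNorm q P.2 b)) := by
        refine Finset.sum_le_sum fun P _ => ?_
        refine (h P.1 P.2 _ (s.blockPart_mem q _ a) _ (s.blockPart_mem q _ b)).trans ?_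
        have h1 := s.norm_blockPart_le q P.1 a
        have h2 := s.norm_blockPart_le q P.2 b
        have h3 := mul_le_mul h1 h2 (norm_nonneg _) ((norm_nonneg _).trans h1)
        have h4 := mul_le_mul_of_nonneg_left h3 (mul_nonneg zero_le_four (hZ P.1 P.2))
        refine h4.trans_eq ?_
        ring
    -- Cauchy–Schwarz over pairs of blocks; the coordinate norms of `a` and `b` then factor and sum
    -- to at most `‖a‖‖b‖`.
    _ ≤ 4 * (√(∑ P : _ × _, (sigma A (P.1.val * q + 1) * sigma A (P.2.val * q + 1) *
          Z P.1 P.2) ^ 2) *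
          √(∑ P : _ × _, (s.blockNorm q P.1 a * s.blockNorm q P.2 b) ^ 2)) := by
        rw [← Finset.mul_sum]
        exact mul_le_mul_of_nonneg_left (Real.sum_mul_le_sqrt_mul_sqrt _ _ _) zero_le_four
    _ ≤ _ := by
        have h5 : √(∑ P : _ × _, (s.blockNorm q P.1 a * s.blockNorm q P.2 b) ^ 2) ≤
            ‖a‖ * ‖b‖ := by
          refine Real.sqrt_le_iff.mpr ⟨by positivity, ?_⟩
          simp only [mul_pow]
          rw [Fintype.sum_prod_type]
          dsimp only
          rw [← Finset.sum_mul_sum]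
          exact mul_le_mul (s.sum_blockNorm_sq_le q a) (s.sum_blockNorm_sq_le q b)
            (Finset.sum_nonneg fun _ _ => sq_nonneg _) (sq_nonneg _)
        rw [← mul_assoc]
        simp only [mul_pow] at h5 ⊢
        gcongr

end ThinSVD

theorem sum_sq_eq_sum_sigma_sq (A : Matrix m n ℝ) : ∑ i, ∑ j, A i j ^ 2 =
    ∑ p ∈ Finset.range (min (Fintype.card m) (Fintype.card n)), sigma A (p + 1) ^ 2 := by
  obtain ⟨s⟩ := nonempty_thinSVD A
  have h1 : ∀ i, ∑ j, A i j ^ 2 = ‖Matrix.toEuclideanLin Aᵀ (EuclideanSpace.single i 1)‖ ^ 2 := by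
    intro i
    rw [EuclideanSpace.norm_sq_eq]
    refine Finset.sum_congr rfl fun j _ => ?_
    simp [Matrix.toLpLin_apply]
  simp only [h1, s.norm_sq_transpose_apply]
  rw [Finset.sum_comm, Finset.sum_range]
  refine Finset.sum_congr rfl fun p _ => ?_
  have h2 := s.orthonormal_u.norm_eq_one p
  have h3 : ‖s.u p‖ ^ 2 = 1 := by rw [h2]; norm_num
  rw [EuclideanSpace.norm_sq_eq] at h3
  simp only [Real.norm_eq_abs, sq_abs] at h3
  simp only [mul_pow, ← Finset.mul_sum]
  simp [EuclideanSpace.inner_single_right, h3]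

theorem sigma_eq_zero_of_min_lt (A : Matrix m n ℝ) {i : ℕ}
    (hi : min (Fintype.card m) (Fintype.card n) < i) : sigma A i = 0 := by
  by_contra h
  have h1 := (sigma_pos_iff A (by omega)).mp ((sigma_nonneg A i).lt_of_ne' h)
  have := rank_le_min A
  omega

theorem sum_range_sigma_sq_le (A : Matrix m n ℝ) (N : ℕ) :
    ∑ p ∈ Finset.range N, sigma A (p + 1) ^ 2 ≤ ∑ i, ∑ j, A i j ^ 2 := by
  rw [sum_sq_eq_sum_sigma_sq]
  rcases le_total N (min (Fintype.card m) (Fintype.card n)) with h | h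
  · exact Finset.sum_le_sum_of_subset_of_nonneg (Finset.range_subset_range.mpr h)
      fun _ _ _ => sq_nonneg _
  · refine le_of_eq (Finset.sum_subset (Finset.range_subset_range.mpr h) fun p _ hp => ?_).symm
    rw [Finset.mem_range, not_lt] at hp
    rw [sigma_eq_zero_of_min_lt A (by omega)]
    norm_num

/-- The leading singular value of a block is at most each of the `q` values in the preceding block.
-/
theorem mul_sum_block_sigma_sq_le (A : Matrix m n ℝ) (q N : ℕ) :
    q * ∑ I ∈ Finset.range N, sigma A ((I + 1) * q + 1) ^ 2 ≤
      ∑ p ∈ Finset.range (N * q), sigma A (p + 1) ^ 2 := by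
  induction N with
  | zero => simp
  | succ N ih =>
    rw [Finset.sum_range_succ, mul_add, Nat.succ_mul, Finset.sum_range_add]
    refine add_le_add ih ?_
    have : (q : ℝ) * sigma A (N * q + q + 1) ^ 2 =
        ∑ _x ∈ Finset.range q, sigma A (N * q + q + 1) ^ 2 := by simp
    rw [this]
    refine Finset.sum_le_sum fun x hx => ?_
    refine pow_le_pow_left₀ (sigma_nonneg _ _) (sigma_anti A ?_) 2
    have := Finset.mem_range.mp hx
    omega

/-- The largest squared singular values of the blocks have a small sum. -/
theorem sum_block_sigma_sq_le (A : Matrix m n ℝ) {q : ℕ} (hq : 0 < q)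
    (hA : ∑ i, ∑ j, A i j ^ 2 ≤ q * specNorm A ^ 2) :
    ∑ I : Fin (min (Fintype.card m) (Fintype.card n)), sigma A (I.val * q + 1) ^ 2 ≤
      2 * specNorm A ^ 2 := by
  rw [← Finset.sum_range fun I => sigma A (I * q + 1) ^ 2]
  refine le_trans (Finset.sum_le_sum_of_subset_of_nonneg
    (Finset.range_subset_range.mpr (Nat.le_succ _)) fun _ _ _ => sq_nonneg _) ?_
  -- The first block contributes `σ_1² = ‖A‖²`. The others, charged to their predecessors,
  -- contribute at most `‖A‖_F²/q ≤ ‖A‖²`.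
  rw [Finset.sum_range_succ']
  have h1 := (mul_sum_block_sigma_sq_le A q (min (Fintype.card m) (Fintype.card n))).trans
    ((sum_range_sigma_sq_le A _).trans hA)
  have hq' : (0 : ℝ) < q := by exact_mod_cast hq
  have h2 := le_of_mul_le_mul_left h1 hq'
  rw [specNorm_eq_sigma_one] at h2 ⊢
  simp only [zero_mul, zero_add]
  linarith

end Blocks

/-! ### From the spectral error to net errors -/

section Gram

variable {n d t : ℕ}

theorem specNorm_le_of_inner_le {m n : Type*} [Fintype m] [DecidableEq m] [Fintype n]
    [DecidableEq n] {X : Matrix m n ℝ} {C : ℝ} (hC : 0 ≤ C)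
    (h : ∀ a b, inner ℝ (Matrix.toEuclideanLin X a) b ≤ C * (‖a‖ * ‖b‖)) : specNorm X ≤ C := by
  refine specNorm_le hC fun a => ?_
  rcases (norm_nonneg (Matrix.toEuclideanLin X a)).eq_or_lt with h0 | h0
  · rw [← h0]; positivity
  refine le_of_mul_le_mul_right ?_ h0
  rw [← real_inner_self_eq_norm_mul_norm, mul_assoc]
  exact h a _

theorem inner_gram_eq_gramError (S : Matrix (Fin t) (Fin d) ℝ) (y z : EuclideanSpace ℝ (Fin d)) :
    inner ℝ (Matrix.toEuclideanLin (Sᵀ * S - 1) y) z = gramError S y z := by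
  rw [map_sub, LinearMap.sub_apply, inner_sub_left, toEuclideanLin_mul_apply,
    inner_toEuclideanLin_transpose, gramError]
  simp [Matrix.toLpLin_apply]

theorem inner_sketched_gram_eq (A : Matrix (Fin n) (Fin d) ℝ) (S : Matrix (Fin t) (Fin d) ℝ)
    (a b : EuclideanSpace ℝ (Fin n)) :
    inner ℝ (Matrix.toEuclideanLin (Aᵀᵀ * Sᵀ * S * Aᵀ - Aᵀᵀ * Aᵀ) a) b =
      inner ℝ (Matrix.toEuclideanLin (Sᵀ * S - 1) (Matrix.toEuclideanLin Aᵀ a))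
        (Matrix.toEuclideanLin Aᵀ b) := by
  have : Aᵀᵀ * Sᵀ * S * Aᵀ - Aᵀᵀ * Aᵀ = A * ((Sᵀ * S - 1) * Aᵀ) := by
    simp only [Matrix.transpose_transpose, Matrix.sub_mul, Matrix.mul_sub, Matrix.one_mul,
      Matrix.mul_assoc]
  rw [this, toEuclideanLin_mul_apply, toEuclideanLin_mul_apply, real_inner_comm,
    ← inner_toEuclideanLin_transpose, real_inner_comm]

/-- If a sketch fails on `Aᵀ`, then a weighted sum of hyperbolic cosines of its errors on nets of
the blocks is large. -/
theorem cosh_le_of_le_specNorm_gram {A : Matrix (Fin n) (Fin d) ℝ} (s : ThinSVD A) {q : ℕ}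
    (hq : 0 < q) (hA : ∑ i, ∑ j, A i j ^ 2 ≤ q * specNorm A ^ 2)
    {N : Fin (min (Fintype.card (Fin n)) (Fintype.card (Fin d))) →
      Finset (EuclideanSpace ℝ (Fin d))}
    (hN : ∀ I, ∀ y ∈ N I, y ∈ s.blockSpan q I ∧ ‖y‖ ≤ 1)
    (hN' : ∀ I, ∀ x ∈ s.blockSpan q I, ‖x‖ ≤ 1 → ∃ y ∈ N I, ‖x - y‖ ≤ 1 / 2)
    {p : Fin (min (Fintype.card (Fin n)) (Fintype.card (Fin d))) ×
      Fin (min (Fintype.card (Fin n)) (Fintype.card (Fin d))) → ℝ} {W : ℝ}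
    (hW : W = ∑ I : Fin (min (Fintype.card (Fin n)) (Fintype.card (Fin d))),
      sigma A (I.val * q + 1) ^ 2) (hW0 : 0 < W)
    (hp : ∀ P, p P = sigma A (P.1.val * q + 1) ^ 2 * sigma A (P.2.val * q + 1) ^ 2 / W ^ 2)
    {S : Matrix (Fin t) (Fin d) ℝ} {ε l : ℝ} (hε : 0 ≤ ε) (hl : 0 ≤ l)
    (hA0 : 0 < specNorm A)
    (hS : ε * specNorm A ^ 2 ≤ specNorm (Aᵀᵀ * Sᵀ * S * Aᵀ - Aᵀᵀ * Aᵀ)) :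
    Real.cosh (l * (ε / 8)) ≤
      ∑ P, p P * ∑ y ∈ N P.1, ∑ z ∈ N P.2, Real.cosh (l * gramError S y z) := by
  -- `Z I J` is the largest absolute error on the two nets. Its `cosh` is one of the positive
  -- summands on the right.
  have hex : ∀ I J, ∃ Z : ℝ, 0 ≤ Z ∧ (∀ y ∈ N I, ∀ z ∈ N J, gramError S y z ≤ Z) ∧
      Real.cosh (l * Z) ≤ ∑ y ∈ N I, ∑ z ∈ N J, Real.cosh (l * gramError S y z) := by
    intro I J
    obtain ⟨y0, hy0, -⟩ := hN' I 0 (Submodule.zero_mem _) (by simp)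
    obtain ⟨z0, hz0, -⟩ := hN' J 0 (Submodule.zero_mem _) (by simp)
    obtain ⟨⟨y, z⟩, hyz, hmax⟩ := Finset.exists_max_image (N I ×ˢ N J)
      (fun P => |gramError S P.1 P.2|) ⟨(y0, z0), Finset.mem_product.mpr ⟨hy0, hz0⟩⟩
    obtain ⟨hy, hz⟩ := Finset.mem_product.mp hyz
    refine ⟨|gramError S y z|, abs_nonneg _, fun y' hy' z' hz' => (le_abs_self _).trans
      (hmax (y', z') (Finset.mem_product.mpr ⟨hy', hz'⟩)), ?_⟩
    have : Real.cosh (l * |gramError S y z|) = Real.cosh (l * gramError S y z) := by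
      rw [← Real.cosh_abs, ← Real.cosh_abs (l * gramError S y z), abs_mul, abs_mul, abs_abs]
    rw [this]
    refine le_trans ?_ (Finset.single_le_sum (f := fun y => ∑ z ∈ N J,
      Real.cosh (l * gramError S y z)) (fun _ _ => Finset.sum_nonneg fun _ _ =>
        (Real.cosh_pos _).le) hy)
    exact Finset.single_le_sum (f := fun z => Real.cosh (l * gramError S y z))
      (fun _ _ => (Real.cosh_pos _).le) hz
  choose Z hZ0 hZ hZc using hex
  have hp0 : ∀ P, 0 ≤ p P := fun P => by rw [hp]; positivity
  have hp1 : ∑ P, p P = 1 := by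
    simp only [hp]
    rw [← Finset.sum_div, Fintype.sum_prod_type]
    dsimp only
    rw [← Finset.sum_mul_sum, ← hW, ← sq, div_self (by positivity)]
  set Q := ∑ P, p P * (Z P.1 P.2) ^ 2 with hQ
  have hQ0 : 0 ≤ Q := Finset.sum_nonneg fun P _ => mul_nonneg (hp0 P) (sq_nonneg _)
  have hsum : ∑ P : _ × _, (sigma A (P.1.val * q + 1) ^ 2 * sigma A (P.2.val * q + 1) ^ 2) *
      Z P.1 P.2 ^ 2 = W ^ 2 * Q := by
    rw [hQ, Finset.mul_sum]
    refine Finset.sum_congr rfl fun P _ => ?_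
    rw [hp]
    field_simp
  have hnorm : specNorm (Aᵀᵀ * Sᵀ * S * Aᵀ - Aᵀᵀ * Aᵀ) ≤ 4 * (W * √Q) := by
    refine specNorm_le_of_inner_le (by positivity) fun a b => ?_
    rw [inner_sketched_gram_eq]
    obtain ⟨T, hT⟩ : ∃ T : EuclideanSpace ℝ (Fin d) →L[ℝ] EuclideanSpace ℝ (Fin d),
        ∀ y, Matrix.toEuclideanLin (Sᵀ * S - 1) y = T y :=
      ⟨LinearMap.toContinuousLinearMap (Matrix.toEuclideanLin (Sᵀ * S - 1)), fun _ => rfl⟩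
    have hT' : ∀ I J, ∀ y ∈ N I, ∀ z ∈ N J, inner ℝ (T y) z ≤ Z I J := by
      intro I J y hy z hz
      rw [← hT, inner_gram_eq_gramError]
      exact hZ I J y hy z hz
    have hT2 : ∀ I J, ∀ y ∈ s.blockSpan q I, ∀ z ∈ s.blockSpan q J,
        inner ℝ (T y) z ≤ 4 * Z I J * (‖y‖ * ‖z‖) := fun I J y hy z hz =>
      inner_le_of_nets T (hN I) (hN' I) (hN J) (hN' J) (hZ0 I J) (hT' I J) hy hz
    rw [hT]
    have h1 := s.inner_apply_transpose_le_of_blocks q T hZ0 hT2 a b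
    rw [hsum, Real.sqrt_mul (sq_nonneg W), Real.sqrt_sq hW0.le] at h1
    exact h1
  have hW2 : W ≤ 2 * specNorm A ^ 2 := hW ▸ sum_block_sigma_sq_le A hq hA
  -- The `8` combines the net factor `4` with `W ≤ 2‖A‖²`.
  have hε8 : ε / 8 ≤ √Q := by
    have h2 : ε * specNorm A ^ 2 ≤ (8 * √Q) * specNorm A ^ 2 := by
      calc _ ≤ 4 * (W * √Q) := hS.trans hnorm
        _ ≤ 4 * ((2 * specNorm A ^ 2) * √Q) := by gcongr
        _ = _ := by ring
    have := le_of_mul_le_mul_right h2 (by positivity)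
    linarith
  calc Real.cosh (l * (ε / 8)) ≤ Real.cosh (l * √Q) := by
        rw [Real.cosh_le_cosh, abs_of_nonneg (by positivity), abs_of_nonneg (by positivity)]
        gcongr
    _ ≤ ∑ P, p P * Real.cosh (l * Z P.1 P.2) :=
        cosh_sqrt_sum_le hp0 hp1 l fun P => Z P.1 P.2
    _ ≤ _ := Finset.sum_le_sum fun P _ => mul_le_mul_of_nonneg_left (hZc P.1 P.2) (hp0 P)

end Gram

end SketchedPCR

namespace SketchedPCR

/-! ### Tail bound for subgaussian sketches -/

section Subgaussian

variable {n d t k : ℕ} {ρ : Measure ℝ} [IsProbabilityMeasure ρ] {c : ℝ≥0}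

/-- The weights `p` sum to one, so averaging over block pairs adds no factor for their number. The
expectation of `H` is at most that of one pair of nets, `25 ^ q` terms. -/
theorem measure_le_of_iid_sketch (h : HasSubgaussianMGF id c ρ) (hv : 0 < Var[id; ρ]) {K : ℝ}
    (hK : 0 < K) (hcK : (c : ℝ) ≤ K * Var[id; ρ]) (ht : 0 < t) {A : Matrix (Fin n) (Fin d) ℝ}
    (hA0 : 0 < specNorm A) {q : ℕ} (hq : 0 < q)
    (hA : ∑ i, ∑ j, A i j ^ 2 ≤ q * specNorm A ^ 2) {ε l : ℝ} (hε : 0 ≤ ε) (hl : 0 ≤ l)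
    (hlK : l ≤ t / (16 * K)) :
    (Measure.pi fun _ : Fin t => Measure.pi fun _ : Fin d => ρ).real {ω |
      ε * specNorm A ^ 2 ≤ specNorm (Aᵀᵀ * (scaledMatrix Var[id; ρ] ω)ᵀ *
        scaledMatrix Var[id; ρ] ω * Aᵀ - Aᵀᵀ * Aᵀ)} ≤
      2 * 25 ^ q * Real.exp (6144 * K ^ 2 * l ^ 2 / t - l * (ε / 8)) := by
  set μ := Measure.pi fun _ : Fin t => Measure.pi fun _ : Fin d => ρ with hμ
  obtain ⟨s⟩ := nonempty_thinSVD A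
  choose N hNc hN hN' using fun I =>
    exists_half_net_submodule (s.blockSpan q I) (s.finrank_blockSpan_le hq I)
  set W := ∑ I : Fin (min (Fintype.card (Fin n)) (Fintype.card (Fin d))),
    sigma A (I.val * q + 1) ^ 2 with hW
  have hσ : 0 < sigma A 1 := specNorm_eq_sigma_one A ▸ hA0
  have hW0 : 0 < W := by
    have hr := ((sigma_pos_iff A le_rfl).mp hσ).trans (rank_le_min A)
    refine Finset.sum_pos' (fun _ _ => sq_nonneg _) ⟨⟨0, hr⟩, Finset.mem_univ _, ?_⟩
    simpa using pow_pos hσ 2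
  set p : Fin (min (Fintype.card (Fin n)) (Fintype.card (Fin d))) ×
      Fin (min (Fintype.card (Fin n)) (Fintype.card (Fin d))) → ℝ := fun P =>
    sigma A (P.1.val * q + 1) ^ 2 * sigma A (P.2.val * q + 1) ^ 2 / W ^ 2 with hp
  have hp0 : ∀ P, 0 ≤ p P := fun P => by rw [hp]; positivity
  have hp1 : ∑ P, p P = 1 := by
    simp only [hp]
    rw [← Finset.sum_div, Fintype.sum_prod_type]
    dsimp only
    rw [← Finset.sum_mul_sum, ← hW, ← sq, div_self (by positivity)]
  set E := Real.exp (6144 * K ^ 2 * l ^ 2 / t) with hE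
  set H : (Fin t → Fin d → ℝ) → ℝ := fun ω =>
    ∑ P, p P * ∑ y ∈ N P.1, ∑ z ∈ N P.2,
      Real.cosh (l * gramError (scaledMatrix Var[id; ρ] ω) y z) with hH
  have hcosh : ∀ I J, ∀ y ∈ N I, ∀ z ∈ N J, _ := fun I J y hy z hz =>
    integral_cosh_gramError_le h hv hK hcK ht (hN I y hy).2 (hN J z hz).2
      (by rwa [abs_of_nonneg hl])
  have hint : ∀ I J, Integrable (fun ω => ∑ y ∈ N I, ∑ z ∈ N J,
      Real.cosh (l * gramError (scaledMatrix Var[id; ρ] ω) y z)) μ := fun I J =>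
    integrable_finsetSum _ fun y hy => integrable_finsetSum _ fun z hz =>
      (hcosh I J y hy z hz).1
  have hHi : Integrable H μ := integrable_finsetSum _ fun P _ => (hint P.1 P.2).const_mul _
  have hblock : ∀ I J, ∫ ω, ∑ y ∈ N I, ∑ z ∈ N J,
      Real.cosh (l * gramError (scaledMatrix Var[id; ρ] ω) y z) ∂μ ≤ 25 ^ q * E := by
    intro I J
    have hcard : ∀ I, ((N I).card : ℝ) ≤ 5 ^ q := fun I => by exact_mod_cast hNc I
    rw [integral_finsetSum _ fun y hy => integrable_finsetSum _ fun z hz =>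
      (hcosh I J y hy z hz).1]
    calc _ ≤ ∑ y ∈ N I, ∑ z ∈ N J, E := by
          refine Finset.sum_le_sum fun y hy => ?_
          rw [integral_finsetSum _ fun z hz => (hcosh I J y hy z hz).1]
          exact Finset.sum_le_sum fun z hz => (hcosh I J y hy z hz).2
      _ = ((N I).card * (N J).card) * E := by simp [mul_assoc]
      _ ≤ (5 ^ q * 5 ^ q) * E := by
          have := hcard I
          have := hcard J
          gcongr
      _ = _ := by rw [← mul_pow]; norm_num
  have hHE : ∫ ω, H ω ∂μ ≤ 25 ^ q * E := by
    rw [hH, integral_finsetSum _ fun P _ => (hint P.1 P.2).const_mul _]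
    calc _ ≤ ∑ P, p P * (25 ^ q * E) := by
          refine Finset.sum_le_sum fun P _ => ?_
          rw [integral_const_mul]
          exact mul_le_mul_of_nonneg_left (hblock P.1 P.2) (hp0 P)
      _ = _ := by rw [← Finset.sum_mul, hp1, one_mul]
  have hmarkov := mul_meas_ge_le_integral_of_nonneg (μ := μ) (f := H)
    (Filter.Eventually.of_forall fun ω => Finset.sum_nonneg fun P _ => mul_nonneg (hp0 P)
      (Finset.sum_nonneg fun _ _ => Finset.sum_nonneg fun _ _ => (Real.cosh_pos _).le)) hHi
    (Real.cosh (l * (ε / 8)))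
  have hsub : μ.real {ω | ε * specNorm A ^ 2 ≤ specNorm (Aᵀᵀ * (scaledMatrix Var[id; ρ] ω)ᵀ *
        scaledMatrix Var[id; ρ] ω * Aᵀ - Aᵀᵀ * Aᵀ)} ≤
      μ.real {ω | Real.cosh (l * (ε / 8)) ≤ H ω} :=
    measureReal_mono fun ω hω => cosh_le_of_le_specNorm_gram s hq hA hN hN' hW hW0
      (fun P => rfl) hε hl hA0 hω
  have hc : Real.exp (l * (ε / 8)) ≤ 2 * Real.cosh (l * (ε / 8)) := by
    rw [Real.cosh_eq]
    linarith [Real.exp_pos (-(l * (ε / 8)))]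
  rw [Real.exp_sub, ← mul_div_assoc, le_div_iff₀ (Real.exp_pos _), ← hE]
  calc _ ≤ μ.real {ω | Real.cosh (l * (ε / 8)) ≤ H ω} * (2 * Real.cosh (l * (ε / 8))) := by
        gcongr
    _ = 2 * (Real.cosh (l * (ε / 8)) * μ.real {ω | Real.cosh (l * (ε / 8)) ≤ H ω}) := by ring
    _ ≤ 2 * (25 ^ q * E) := mul_le_mul_of_nonneg_left (hmarkov.trans hHE) zero_le_two
    _ = _ := by ring

theorem approxGram_iidMap_of_le (h : HasSubgaussianMGF id c ρ) (hv : 0 < Var[id; ρ]) {K : ℝ}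
    (hK : 1 ≤ K) (hcK : (c : ℝ) ≤ K * Var[id; ρ]) {A : Matrix (Fin n) (Fin d) ℝ}
    (hA0 : 0 < specNorm A) {ε δ : ℝ} (hε : 0 < ε) (hε1 : ε ≤ 1) (hδ : 0 < δ) (hδ1 : δ < 1)
    (ht : 14155776 * K ^ 2 * (stableRank A + Real.log (1 / δ)) / ε ^ 2 ≤ t) :
    ApproxGram (iidMap t d ρ) Aᵀ ε δ := by
  have hsr := one_le_stableRank hA0
  have hlog : 0 < Real.log (1 / δ) := Real.log_pos (by rw [lt_div_iff₀ hδ]; linarith)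
  have ht0 : (0 : ℝ) < t := lt_of_lt_of_le (by positivity) ht
  have ht' : 0 < t := by exact_mod_cast ht0
  have hmeas : Measurable (scaledMatrix Var[id; ρ] : (Fin t → Fin d → ℝ) → _) := by
    have : Continuous (fun ω : Fin t → Fin d → ℝ => fun i j => ω i j / √(t * Var[id; ρ])) := by
      fun_prop
    exact this.measurable
  have hlaw : iidMap t d ρ =
      (Measure.pi fun _ : Fin t => Measure.pi fun _ : Fin d => ρ).map
        (scaledMatrix Var[id; ρ]) := rfl
  refine ⟨hlaw ▸ Measure.isProbabilityMeasure_map hmeas.aemeasurable, ?_⟩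
  rw [hlaw, Measure.map_apply hmeas (measurableSet_le_specNorm_gram _ _), specNorm_transpose]
  refine (ENNReal.le_ofReal_iff_toReal_le (measure_ne_top _ _) hδ.le).mpr ?_
  set q := ⌈stableRank A⌉₊ with hq
  have hq0 : 0 < q := Nat.ceil_pos.mpr (by linarith)
  have hq2 : (q : ℝ) ≤ 2 * stableRank A := by
    have := Nat.ceil_lt_add_one (by linarith : 0 ≤ stableRank A)
    linarith
  have hA : ∑ i, ∑ j, A i j ^ 2 ≤ q * specNorm A ^ 2 := by
    have : (∑ i, ∑ j, A i j ^ 2) = stableRank A * specNorm A ^ 2 := by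
      rw [stableRank, div_mul_cancel₀ _ (by positivity)]
    rw [this]
    gcongr
    exact Nat.le_ceil _
  -- This `l` minimizes `6144 K² l²/t - l ε/8`, with value `-ε² t/(1572864 K²)`. It is admissible
  -- because `K ≥ 1` and `ε ≤ 1`.
  have hl : ε * t / (98304 * K ^ 2) ≤ t / (16 * K) := by
    rw [div_le_div_iff₀ (by positivity) (by positivity)]
    have h1 : ε * K ≤ 98304 / 16 * K ^ 2 := by nlinarith
    nlinarith [mul_le_mul_of_nonneg_left h1 ht0.le]
  refine (measure_le_of_iid_sketch h hv (by linarith) hcK ht' hA0 hq0 hA hε.le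
    (l := ε * t / (98304 * K ^ 2)) (by positivity) hl).trans ?_
  have hexp : 6144 * K ^ 2 * (ε * t / (98304 * K ^ 2)) ^ 2 / t -
      ε * t / (98304 * K ^ 2) * (ε / 8) = -(ε ^ 2 * t / (1572864 * K ^ 2)) := by
    field_simp
    norm_num
  -- `14155776 = 9 · 1572864`. The `9` pays for the prefactor, since `2 · 25^q ≤ exp (1 + 4q)` and
  -- `1 + 4q ≤ 1 + 8 sr ≤ 9 sr`.
  have ht2 : 9 * (stableRank A + Real.log (1 / δ)) ≤ ε ^ 2 * t / (1572864 * K ^ 2) := by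
    rw [div_le_iff₀ (by positivity)] at ht
    rw [le_div_iff₀ (by positivity)]
    linarith
  have h25 : (25 : ℝ) ≤ Real.exp 4 := by
    have h1 : (2.7 : ℝ) ≤ Real.exp 1 := by linarith [Real.exp_one_gt_d9]
    have h2 := pow_le_pow_left₀ (by norm_num) h1 4
    rw [← Real.exp_nat_mul] at h2
    norm_num at h2 ⊢
    linarith
  have h2e : (2 : ℝ) ≤ Real.exp 1 := by linarith [Real.exp_one_gt_d9]
  have hδe : δ = Real.exp (-Real.log (1 / δ)) := by
    rw [one_div, Real.log_inv, neg_neg, Real.exp_log hδ]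
  rw [hexp]
  calc 2 * 25 ^ q * Real.exp (-(ε ^ 2 * t / (1572864 * K ^ 2)))
      ≤ Real.exp 1 * Real.exp 4 ^ q * Real.exp (-(ε ^ 2 * t / (1572864 * K ^ 2))) := by
        gcongr
    _ = Real.exp (1 + q * 4 + -(ε ^ 2 * t / (1572864 * K ^ 2))) := by
        rw [← Real.exp_nat_mul, Real.exp_add, Real.exp_add]
    _ ≤ Real.exp (-Real.log (1 / δ)) := Real.exp_le_exp.mpr (by linarith)
    _ = δ := hδe.symm

theorem approxGram_iidMap (h : HasSubgaussianMGF id c ρ) (hv : 0 < Var[id; ρ]) {K : ℝ}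
    (hK : 1 ≤ K) (hcK : (c : ℝ) ≤ K * Var[id; ρ]) {A : Matrix (Fin n) (Fin d) ℝ}
    (hk : 1 ≤ k) (hr : k ≤ A.rank) (hgap : sigma A (k + 1) < sigma A k) {ν δ : ℝ} (hν : 0 < ν)
    (hν' : ν < 1 / 2) (hδ : 0 < δ) (hδ1 : δ < 1 / 2)
    (ht : 31850496 * K ^ 2 * ((stableRank A + Real.log (1 / δ)) / (gap A k ^ 2 * ν ^ 2)) ≤ t) :
    ApproxGram (iidMap t d ρ) Aᵀ (ν / (1 + ν) * gap A k) δ := by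
  have hA := specNorm_pos hk hr
  have hg := gap_pos hk hr hgap
  have hsr := one_le_stableRank hA
  have hlog : 0 < Real.log (1 / δ) := Real.log_pos (by rw [lt_div_iff₀ hδ]; linarith)
  have hε : 0 < ν / (1 + ν) * gap A k := by positivity
  have hε1 : ν / (1 + ν) * gap A k ≤ 1 := by
    refine mul_le_one₀ ?_ hg.le (gap_le_one hk hr)
    rw [div_le_one (by positivity)]
    linarith
  refine approxGram_iidMap_of_le h hv hK hcK hA hε hε1 hδ (by linarith) (le_trans ?_ ht)
  rw [← mul_div_assoc, div_le_div_iff₀ (by positivity) (by positivity)]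
  have := mul_le_mul_of_nonneg_left (gap_sq_mul_sq_le (A := A) (k := k) hν hν')
    (by positivity : 0 ≤ 14155776 * K ^ 2 * (stableRank A + Real.log (1 / δ)))
  linarith

end Subgaussian

end SketchedPCR

/-! ### The main theorem -/

theorem mainTheorem5 :
    -- the guarantee for every sketching distribution with the approximate Gram property
    (∀ (n d t k : ℕ) (A : Matrix (Fin n) (Fin d) ℝ) (sA : ThinSVD A),
      1 ≤ k → k ≤ A.rank → sigma A (k + 1) < sigma A k →
      ∀ ν δ : ℝ, 0 < ν → ν < 1 / 2 → 0 < δ → δ < 1 / 2 →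
      ∀ D : Measure (Matrix (Fin t) (Fin d) ℝ),
      ApproxGram D Aᵀ (ν / (1 + ν) * gap A k) δ →
      ∀ (Ω : Type*) [MeasurableSpace Ω] (μ : Measure Ω) [IsProbabilityMeasure μ]
        (f : EuclideanSpace ℝ (Fin n)) (ξ : Fin n → Ω → ℝ) (σ : ℝ), IsNoise μ ξ σ →
      ∀ xstar : EuclideanSpace ℝ (Fin d), IsOptimalPredictor μ ξ f A xstar →
      ∀ xk : EuclideanSpace ℝ (Fin n) → EuclideanSpace ℝ (Fin d),
      (∀ b, IsPCRSolution sA k b (xk b)) →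
      D {G | ¬ ∀ s : ThinSVD (A * Gᵀ),
          (∀ b, IsApproxPCP sA k ν ν b
            (Matrix.toEuclideanLin A (compressedPCR A Gᵀ s k b))) ∧
          excessRisk μ ξ f A xstar (compressedPCR A Gᵀ s k) ≤
            excessRisk μ ξ f A xstar xk + (2 * ν + ν ^ 2) * ‖f‖ ^ 2 / n}
        ≤ ENNReal.ofReal δ) ∧
    -- CountSketch: a sufficient number of rows
    (∃ C : ℝ, 0 < C ∧ ∀ (n d t k : ℕ) (A : Matrix (Fin n) (Fin d) ℝ),
      1 ≤ k → k ≤ A.rank → sigma A (k + 1) < sigma A k →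
      ∀ ν δ : ℝ, 0 < ν → ν < 1 / 2 → 0 < δ → δ < 1 / 2 →
      C * (stableRank A ^ 2 / (gap A k ^ 2 * ν ^ 2 * δ)) ≤ t →
      ApproxGram (countSketch t d) Aᵀ (ν / (1 + ν) * gap A k) δ) ∧
    -- subgaussian maps: a sufficient number of rows
    (∀ K : ℝ, 0 < K → ∃ C : ℝ, 0 < C ∧
      ∀ (ρ : Measure ℝ) [IsProbabilityMeasure ρ] (c : ℝ≥0),
      HasSubgaussianMGF id c ρ → 0 < Var[id; ρ] → (c : ℝ) ≤ K * Var[id; ρ] →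
      ∀ (n d t k : ℕ) (A : Matrix (Fin n) (Fin d) ℝ),
      1 ≤ k → k ≤ A.rank → sigma A (k + 1) < sigma A k →
      ∀ ν δ : ℝ, 0 < ν → ν < 1 / 2 → 0 < δ → δ < 1 / 2 →
      C * ((stableRank A + Real.log (1 / δ)) / (gap A k ^ 2 * ν ^ 2)) ≤ t →
      ApproxGram (iidMap t d ρ) Aᵀ (ν / (1 + ν) * gap A k) δ) := by
  refine ⟨?_, ⟨9 / 2, by norm_num, ?_⟩, ?_⟩
  · intro n d t k A sA hk hr hgap ν δ hν _ _ _ D hD Ω _ μ _ f ξ σ hξ xstar hx xk hxk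
    -- The failure set lies in the one Gram failure event, for all `b` and all SVDs at once;
    -- monotonicity requires no measurability of the former.
    refine (measure_mono fun G hG => ?_).trans hD.2
    by_contra hlt
    refine hG (compressedPCR_guarantee sA hk hr hgap hν ?_ hξ hx hxk)
    rw [Set.mem_ofPred_eq, not_le, specNorm_transpose] at hlt
    simpa [Matrix.mul_assoc] using hlt.le
  · intro n d t k A hk hr hgap ν δ hν hν' hδ _ ht
    exact approxGram_countSketch hk hr hgap hν hν' hδ ht
  · intro K hK
    -- `31850496 = 14155776 · 9/4`, the conversion from `ε` to `ν` and the gap. Replacing `K` by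
    -- `max K 1` only weakens `c ≤ K v`.
    refine ⟨31850496 * max K 1 ^ 2, by positivity, ?_⟩
    intro ρ _ c h hv hcK n d t k A hk hr hgap ν δ hν hν' hδ hδ1 ht
    exact approxGram_iidMap h hv (le_max_right K 1)
      (hcK.trans (mul_le_mul_of_nonneg_right (le_max_left K 1) hv.le)) hk hr hgap hν hν' hδ hδ1 ht
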